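/- For $\sigma\ge 0$ let $L_2^\sigma(0,1)$ be $L_2(0,1)$ with the inner product $\langle x,y\rangle_\sigma=\int_0^1 e^{-2\sigma t}x(t)y(t)\,dt$ and norm $\|\cdot\|_\sigma$; $\|\cdot\|=\|\cdot\|_0$ is the usual norm. Let $[F(x)](s)=\int_0^s x(s-t)x(t)\,dt$ be the autoconvolution operator and $[F'(x)h](s)=2\int_0^s x(s-t)h(t)\,dt$ its Fréchet derivative. Put $\|x\|_{C^1}=\max\{\|x\|_\infty,\|x'\|_\infty\}$, and let $H_1^\sigma(0,1)$ be the space of absolutely continuous functions with derivative in $L_2(0,1)$, with norm $\|x\|_{H_1^\sigma}=\frac12(\|x\|_\sigma^2+\|x'\|_\sigma^2)^{1/2}$. Let $x_0\in W^2_\infty(0,1)$ (continuous representative on $[0,1]$) be positive on $(0,1)$ with $x_0(0)>0$. Let $\sigma>0$ be such that $F'(x_0)$ is accretive in $L_2^\sigma(0,1)$, i.e. $\langle F'(x_0)v,v\rangle_\sigma\ge 0$ for all $v\in L_2(0,1)$, and such that the solution $\omega\in L_2(0,1)$ of $F'(x_0)\omega=x_0-x_0(0)$ obeys $\|\omega\|_\sigma<\frac14$.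 Let $L\in\mathbb R$. Then there are constants $c>0$ and $\delta_0\in(0,1]$, depending only on $x_0$, $\sigma$ and $L$, such that the following holds. Let $X_m\subset L_2(0,1)$, $m\in\mathbb N$, be subspaces with $\dim X_m=m$ and $$\inf_{z\in X_m}\|x-z\|_\sigma\le \frac Lm\|x\|_{H_1^\sigma}\qquad (x\in H_1^\sigma(0,1),\ m\ge 1),$$ and let $Q_m$ be the projection onto $X_m$ that is orthogonal in $L_2^\sigma(0,1)$. Let $0<\delta\le\delta_0$, $m\ge\sigma/\delta$, and let $y^\delta=F(x_0)+\xi$ with $\xi\in L_2(0,1)$, $\|\xi\|\le\delta$. Let $x_*$ be the constant function with value $$\sqrt{\frac2{h^2}\int_0^h y^\delta(t)\,dt},\qquad h=\Bigl(\tfrac23\|x_0\|_{C^1}^2\Bigr)^{-2/5}\delta^{2/5}$$ (the root of a negative number being read as $0$), and let $\alpha=c\,\delta^{2/5}$. Then the discretized Lavrent'ev equation $$\alpha Q_m(x_*-x)+Q_m y^\delta=Q_mF(Q_mx)$$ has a solution $x=x_\alpha^\delta\in X_m$ with $$\|x_0-x_\alpha^\delta\|_\sigma\le c\,\delta^{2/5}\qquad\text{and}\qquad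 \|x_0-x_\alpha^\delta\|\le e^{\sigma}c\,\delta^{2/5}.$$ -/

import Mathlib

open MeasureTheory Set
open scoped ENNReal InnerProductSpace

namespace Autoconv

noncomputable section

/-- Lebesgue measure on the interval `(0,1)`. -/
def unitVol : Measure ℝ := volume.restrict (Ioo (0 : ℝ) 1)

/-- The measure `e^{-2σt} dt` on `(0,1)`. -/
def weightedVol (σ : ℝ) : Measure ℝ :=
  unitVol.withDensity fun t => ENNReal.ofReal (Real.exp (-(2 * σ * t)))

instance : IsFiniteMeasure unitVol := by
  unfold unitVol; infer_instance

theorem weightedVol_le (σ : ℝ) :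
    weightedVol σ ≤ ENNReal.ofReal (Real.exp (2 * |σ|)) • unitVol := by
  rw [weightedVol, ← withDensity_const]
  refine withDensity_mono ?_
  unfold unitVol
  filter_upwards [ae_restrict_mem measurableSet_Ioo] with t ht
  refine ENNReal.ofReal_le_ofReal (Real.exp_le_exp.2 ?_)
  have h1 : -σ ≤ |σ| := neg_le_abs σ
  have h2 : 0 ≤ |σ| := abs_nonneg σ
  nlinarith [ht.1, ht.2]

theorem unitVol_le (σ : ℝ) :
    unitVol ≤ ENNReal.ofReal (Real.exp (2 * |σ|)) • weightedVol σ := by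
  have hm : Measurable fun t : ℝ => ENNReal.ofReal (Real.exp (-(2 * σ * t))) := by fun_prop
  rw [weightedVol, ← withDensity_smul _ hm]
  conv_lhs => rw [← withDensity_one (μ := unitVol)]
  refine withDensity_mono ?_
  unfold unitVol
  filter_upwards [ae_restrict_mem measurableSet_Ioo] with t ht
  simp only [Pi.one_apply, Pi.smul_apply, smul_eq_mul]
  rw [← ENNReal.ofReal_mul (Real.exp_pos _).le, ← Real.exp_add, ENNReal.one_le_ofReal]
  refine Real.one_le_exp ?_
  have h1 : σ ≤ |σ| := le_abs_self σ
  have h2 : 0 ≤ |σ| := abs_nonneg σ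
  nlinarith [ht.1, ht.2]

/-- Square integrability for the weight `e^{-2σt}` is ordinary square integrability. -/
theorem memLp_weightedVol_iff (σ : ℝ) (f : ℝ → ℝ) :
    MemLp f 2 (weightedVol σ) ↔ MemLp f 2 unitVol :=
  ⟨fun h => h.of_measure_le_smul ENNReal.ofReal_ne_top (unitVol_le σ),
   fun h => h.of_measure_le_smul ENNReal.ofReal_ne_top (weightedVol_le σ)⟩

/-- The space `L₂(0,1)`. -/
abbrev UnitL2 : Type := Lp ℝ 2 unitVol

/-- The Hilbert space `L₂^σ(0,1)` with inner product `∫₀¹ e^{-2σt} x(t) y(t) dt`. -/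
abbrev WeightedL2 (σ : ℝ) : Type := Lp ℝ 2 (weightedVol σ)

/-- The element of `L₂^σ(0,1)` given by a square integrable function on `(0,1)`. -/
def toWL2 (σ : ℝ) (f : ℝ → ℝ) (hf : MemLp f 2 unitVol) : WeightedL2 σ :=
  ((memLp_weightedVol_iff σ f).2 hf).toLp f

/-- A constant function as an element of `L₂^σ(0,1)`. -/
def constWL2 (σ a : ℝ) : WeightedL2 σ :=
  toWL2 σ (fun _ => a) (memLp_const a)

/-- The Volterra convolution `s ↦ ∫₀ˢ x(s-t) y(t) dt`. -/
def conv (x y : ℝ → ℝ) (s : ℝ) : ℝ := ∫ t in (0 : ℝ)..s, x (s - t) * y t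

theorem conv_memLp {x y : ℝ → ℝ} (hx : MemLp x 2 unitVol) (hy : MemLp y 2 unitVol) :
    MemLp (conv x y) 2 unitVol := by
  have hx2 : IntegrableOn (fun t => x t ^ 2) (Ioo 0 1) := hx.integrable_sq
  have hy2 : IntegrableOn (fun t => y t ^ 2) (Ioo 0 1) := hy.integrable_sq
  have hX : AEStronglyMeasurable ((Ioo (0 : ℝ) 1).indicator x) volume :=
    (aestronglyMeasurable_indicator_iff measurableSet_Ioo).2 hx.1
  have hY : AEStronglyMeasurable ((Ioo (0 : ℝ) 1).indicator y) volume :=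
    (aestronglyMeasurable_indicator_iff measurableSet_Ioo).2 hy.1
  have hmeas : AEStronglyMeasurable
      (fun s => ∫ t, (Ioo (0 : ℝ) 1).indicator y t * (Ioo (0 : ℝ) 1).indicator x (s - t))
      volume :=
    (hY.convolution_integrand (ContinuousLinearMap.mul ℝ ℝ) hX).integral_prod_right'
  have hEq : ∀ s ∈ Ioo (0 : ℝ) 1,
      (∫ t, (Ioo (0 : ℝ) 1).indicator y t * (Ioo (0 : ℝ) 1).indicator x (s - t))
        = conv x y s := by
    intro s hs
    rw [conv, intervalIntegral.integral_of_le hs.1.le, integral_Ioc_eq_integral_Ioo,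
      ← integral_indicator measurableSet_Ioo]
    congr 1
    funext t
    by_cases ht : t ∈ Ioo 0 s
    · have h1 : t ∈ Ioo (0 : ℝ) 1 := ⟨ht.1, ht.2.trans hs.2⟩
      have h2 : s - t ∈ Ioo (0 : ℝ) 1 := ⟨by linarith [ht.2], by linarith [ht.1, hs.2]⟩
      rw [indicator_of_mem h1, indicator_of_mem h2, indicator_of_mem ht, mul_comm]
    · rw [indicator_of_notMem ht]
      by_cases h1 : t ∈ Ioo (0 : ℝ) 1
      · have h2 : s - t ∉ Ioo (0 : ℝ) 1 := fun h => ht ⟨h1.1, by linarith [h.1]⟩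
        rw [indicator_of_notMem h2, mul_zero]
      · rw [indicator_of_notMem h1, zero_mul]
  have hM : AEStronglyMeasurable (conv x y) unitVol := by
    refine (hmeas.restrict (s := Ioo (0 : ℝ) 1)).congr ?_
    filter_upwards [ae_restrict_mem measurableSet_Ioo] with s hs
    exact hEq s hs
  refine MemLp.of_bound hM
    ((∫ t in Ioo (0 : ℝ) 1, x t ^ 2) + ∫ t in Ioo (0 : ℝ) 1, y t ^ 2) ?_
  unfold unitVol
  filter_upwards [ae_restrict_mem measurableSet_Ioo] with s hs
  have hsub : Ioc 0 s ⊆ Ioo (0 : ℝ) 1 := fun t ht => ⟨ht.1, ht.2.trans_lt hs.2⟩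
  have ix : IntervalIntegrable (fun t => x t ^ 2) volume 0 s :=
    (intervalIntegrable_iff_integrableOn_Ioc_of_le hs.1.le).2 (hx2.mono_set hsub)
  have iy : IntervalIntegrable (fun t => y t ^ 2) volume 0 s :=
    (intervalIntegrable_iff_integrableOn_Ioc_of_le hs.1.le).2 (hy2.mono_set hsub)
  have ix' : IntervalIntegrable (fun t => x (s - t) ^ 2) volume 0 s := by
    have := ix.comp_sub_left s
    simpa using this.symm
  have hb : ‖conv x y s‖ ≤ ∫ t in (0 : ℝ)..s, (x (s - t) ^ 2 + y t ^ 2) := by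
    refine intervalIntegral.norm_integral_le_of_norm_le hs.1.le ?_ (ix'.add iy)
    refine Filter.Eventually.of_forall fun t _ => ?_
    rw [Real.norm_eq_abs, abs_le]
    constructor <;>
      nlinarith [sq_nonneg (x (s - t) + y t), sq_nonneg (x (s - t) - y t),
        sq_nonneg (x (s - t)), sq_nonneg (y t)]
  refine hb.trans ?_
  rw [intervalIntegral.integral_add ix' iy,
    intervalIntegral.integral_comp_sub_left (fun t => x t ^ 2) s, sub_self, sub_zero,
    intervalIntegral.integral_of_le hs.1.le, intervalIntegral.integral_of_le hs.1.le]
  refine add_le_add ?_ ?_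
  · exact setIntegral_mono_set hx2 (Filter.Eventually.of_forall fun t => sq_nonneg _)
      hsub.eventuallyLE
  · exact setIntegral_mono_set hy2 (Filter.Eventually.of_forall fun t => sq_nonneg _)
      hsub.eventuallyLE

/-- The Volterra convolution as a map on `L₂^σ(0,1)`. -/
def convWL2 {σ : ℝ} (x y : WeightedL2 σ) : WeightedL2 σ :=
  toWL2 σ (conv x y)
    (conv_memLp ((memLp_weightedVol_iff σ x).1 (Lp.memLp x))
      ((memLp_weightedVol_iff σ y).1 (Lp.memLp y)))

/-- The autoconvolution operator `[F(x)](s) = ∫₀ˢ x(s-t) x(t) dt`. -/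
def F {σ : ℝ} (x : WeightedL2 σ) : WeightedL2 σ := convWL2 x x

/-- The Fréchet derivative `[F'(x)h](s) = 2 ∫₀ˢ x(s-t) h(t) dt`. -/
def F' {σ : ℝ} (x h : WeightedL2 σ) : WeightedL2 σ := (2 : ℝ) • convWL2 x h

/-- `g` is the weak derivative of `f` on `(0,1)`. -/
def HasWeakDeriv (f g : ℝ → ℝ) : Prop :=
  LocallyIntegrableOn f (Ioo 0 1) ∧ LocallyIntegrableOn g (Ioo 0 1) ∧
    ∀ φ : ℝ → ℝ, ContDiff ℝ (⊤ : ℕ∞) φ → HasCompactSupport φ → tsupport φ ⊆ Ioo 0 1 →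
      ∫ t in Ioo (0 : ℝ) 1, f t * deriv φ t = -∫ t in Ioo (0 : ℝ) 1, g t * φ t

/-- The class of `f` on `(0,1)` belongs to the Sobolev space `W²_∞(0,1)`. -/
def MemW2Inf (f : ℝ → ℝ) : Prop :=
  MemLp f ∞ unitVol ∧ ∃ f₁ f₂ : ℝ → ℝ, MemLp f₁ ∞ unitVol ∧ MemLp f₂ ∞ unitVol ∧
    HasWeakDeriv f f₁ ∧ HasWeakDeriv f₁ f₂

/-- Smoothness of the exact solution. The function `x₀` is the continuous representative on
`[0,1]` of its class, so that `x₀ 0` is the initial value. -/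
structure SolutionSmoothness (x₀ : ℝ → ℝ) : Prop where
  continuousOn : ContinuousOn x₀ (Icc 0 1)
  memW2Inf : MemW2Inf x₀
  pos : ∀ t ∈ Ioo (0 : ℝ) 1, 0 < x₀ t
  pos_zero : 0 < x₀ 0

theorem memLp_of_continuousOn {f : ℝ → ℝ} (hf : ContinuousOn f (Icc 0 1)) :
    MemLp f 2 unitVol := by
  obtain ⟨C, hC⟩ := isCompact_Icc.exists_bound_of_continuousOn hf
  refine MemLp.of_bound ((hf.mono Ioo_subset_Icc_self).aestronglyMeasurable measurableSet_Ioo)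
    C ?_
  unfold unitVol
  filter_upwards [ae_restrict_mem measurableSet_Ioo] with t ht
  exact hC t (Ioo_subset_Icc_self ht)

/-- The exact solution as an element of `L₂^σ(0,1)`. -/
def SolutionSmoothness.elt {x₀ : ℝ → ℝ} (h : SolutionSmoothness x₀) (σ : ℝ) : WeightedL2 σ :=
  toWL2 σ x₀ (memLp_of_continuousOn h.continuousOn)

/-- The norm `max {‖x‖_∞, ‖x'‖_∞}` of `C¹(0,1)`. -/
def c1Norm (x : ℝ → ℝ) : ℝ :=
  max (eLpNorm x ∞ unitVol).toReal (eLpNorm (deriv x) ∞ unitVol).toReal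

/-- `H₁^σ(0,1)`: absolutely continuous functions with square integrable derivative. -/
structure MemH1 (x : ℝ → ℝ) : Prop where
  absolutelyContinuous : AbsolutelyContinuousOnInterval x 0 1
  deriv_memLp : MemLp (deriv x) 2 unitVol

theorem MemH1.memLp {x : ℝ → ℝ} (hx : MemH1 x) : MemLp x 2 unitVol :=
  memLp_of_continuousOn (by
    simpa [uIcc_of_le (zero_le_one' ℝ)] using hx.absolutelyContinuous.continuousOn)

/-- The norm `½ (‖x‖_σ² + ‖x'‖_σ²)^{1/2}` of `H₁^σ(0,1)`. -/
def h1Norm (σ : ℝ) {x : ℝ → ℝ} (hx : MemH1 x) : ℝ :=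
  1 / 2 * √(‖toWL2 σ x hx.memLp‖ ^ 2 + ‖toWL2 σ (deriv x) hx.deriv_memLp‖ ^ 2)

/-- Approximation power of the spaces `X_m`, `m = 1, 2, …`, with constant `L`. -/
structure ApproximationPower (σ L : ℝ) (X : ℕ → Submodule ℝ (WeightedL2 σ)) : Prop where
  finrank_eq : ∀ m : ℕ, 1 ≤ m → Module.finrank ℝ (X m) = m
  infDist_le : ∀ m : ℕ, 1 ≤ m → ∀ (x : ℝ → ℝ) (hx : MemH1 x),
    Metric.infDist (toWL2 σ x hx.memLp) (X m : Set (WeightedL2 σ)) ≤ L / m * h1Norm σ hx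

/-- The noisy data `y^δ = F(x₀) + ξ`, with `ξ ∈ L₂(0,1)`. -/
def noisyData {σ : ℝ} (x₀ : WeightedL2 σ) (ξ : UnitL2) : WeightedL2 σ :=
  F x₀ + toWL2 σ ξ (Lp.memLp ξ)

/-- The averaging length `h = (⅔ ‖x₀‖²_{C¹})^{-2/5} δ^{2/5}`. -/
def averagingLength (x₀ : ℝ → ℝ) (δ : ℝ) : ℝ :=
  (2 / 3 * c1Norm x₀ ^ 2) ^ (-(2 / 5) : ℝ) * δ ^ (2 / 5 : ℝ)

/-- The constant reference element with value `√(2/h² ∫₀ʰ y(t) dt)`, where the root of a negative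
number is `0`. -/
def referenceElement {σ : ℝ} (h : ℝ) (y : WeightedL2 σ) : WeightedL2 σ :=
  constWL2 σ (√(2 / h ^ 2 * ∫ t in (0 : ℝ)..h, y t))

/-- `x ∈ X` solves `α Q (x_* - x) + Q y = Q F(Q x)`, with `Q` the orthogonal projection of
`L₂^σ(0,1)` onto `X`. -/
def IsDiscreteLavrentievSolution {σ : ℝ} (X : Submodule ℝ (WeightedL2 σ))
    [X.HasOrthogonalProjection] (α : ℝ) (xref y x : WeightedL2 σ) : Prop :=
  x ∈ X ∧
    α • X.starProjection (xref - x) + X.starProjection y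
      = X.starProjection (F (X.starProjection x))

end

end Autoconv

/-! Write `Q` for the projection, `A = F'(x₀)`, `p = x₀ - Q x₀`. Since `F` is quadratic, `F(x) =
F(x₀) + A(x - x₀) + F(x - x₀)` exactly. With `T = Q A Q`, the discrete equation for `z = x - Q x₀`
becomes `(α + T) z = Q(small - F(z - p)) - α T ω`, where `ω` is the source element, `A ω = x₀ -
x₀(0)`. Accretivity makes `T` monotone, so `R = (α + T)⁻¹` satisfies `‖R‖ ≤ 1/α` and `‖R T‖ ≤ 1`
(`exists_resolvent`). Because `‖x * y‖_σ ≤ ‖x‖_σ ‖y‖_σ` (`norm_convWL2_le`), the fixed-point map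
contracts the ball of radius `s α` about `p` when `s < 1/2`. It maps the ball to itself when `s² +
‖ω‖ < s` with room for the small terms; `‖ω‖ < 1/4` is what makes such an `s` available.

The small terms have order `δ^{2/5}`. Near zero `x₀ * x₀` is `x₀(0)² s + O(s²)`, so averaging over
length `h` recovers `x₀(0)` up to `O(h + δ h^{-3/2})`, balanced by `h ~ δ^{2/5}`. The projection
errors of `x₀` and `ω` are `O(1/m) = O(δ)`, provided `ω` lies in `H₁`. Differentiating the source
equation gives a Volterra equation of the second kind, `x₀(0) ω + x₀' * ω = x₀'/2`, whose solution
is Lipschitz because `x₀'` is (`SolutionSmoothness.exists_source`). A large `c` in `α = c δ^{2/5}`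
then absorbs all constants. -/

namespace Autoconv

noncomputable section

/-! ### The projected Lavrent'ev equation in a Hilbert space -/

section Abstract

variable {H : Type*} [NormedAddCommGroup H] [InnerProductSpace ℝ H] [CompleteSpace H]

/-- The resolvent `(α + T)⁻¹` of a bounded monotone operator `T` on a Hilbert space. -/
theorem exists_resolvent (T : H →L[ℝ] H) (hT : ∀ v, 0 ≤ ⟪T v, v⟫_ℝ) {α : ℝ} (hα : 0 < α) :
    ∃ R : H →L[ℝ] H, (∀ g, α • R g + T (R g) = g) ∧ (∀ g, ‖R g‖ ≤ ‖g‖ / α) ∧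
      ∀ w, ‖R (T w)‖ ≤ ‖w‖ := by
  set S : H →L[ℝ] H := α • ContinuousLinearMap.id ℝ H + T with hS
  have hSv : ∀ v, S v = α • v + T v := fun v => by simp [hS]
  have hlow : ∀ v, α * ‖v‖ ^ 2 ≤ ⟪S v, v⟫_ℝ := fun v => by
    rw [hSv, inner_add_left, real_inner_smul_left, real_inner_self_eq_norm_sq]
    linarith [hT v]
  -- Lax-Milgram: monotonicity makes the form of `α + T` coercive with constant `α`.
  have hco : IsCoercive ((innerSL ℝ).comp S) :=
    ⟨α, hα, fun u => by
      rw [mul_assoc, ← sq]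
      exact hlow u⟩
  have hE : ∀ v, hco.continuousLinearEquivOfBilin v = S v := fun v =>
    (hco.unique_continuousLinearEquivOfBilin fun w => rfl).symm
  have hR : ∀ g, α • hco.continuousLinearEquivOfBilin.symm g
      + T (hco.continuousLinearEquivOfBilin.symm g) = g := fun g => by
    rw [← hSv, ← hE, ContinuousLinearEquiv.apply_symm_apply]
  refine ⟨hco.continuousLinearEquivOfBilin.symm, hR, fun g => ?_, fun w => ?_⟩
  · set v := hco.continuousLinearEquivOfBilin.symm g with hv
    have h1 := hlow v
    rw [hSv, hR] at h1
    have h2 := real_inner_le_norm g v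
    rw [le_div_iff₀ hα]
    rcases (norm_nonneg v).eq_or_lt with h0 | h0
    · simp only [ContinuousLinearEquiv.coe_coe, ← hv, ← h0, zero_mul, norm_nonneg]
    · refine le_of_mul_le_mul_right ?_ h0
      simp only [ContinuousLinearEquiv.coe_coe, ← hv]
      nlinarith
  · set v := hco.continuousLinearEquivOfBilin.symm (T w) with hv
    -- For `v = R T w`, testing this identity with `v - w` gives `⟪v, v - w⟫ ≤ 0`, hence `‖v‖ ≤
    -- ‖w‖`, a bound free of `α`.
    have h1 : α • v + T (v - w) = 0 := by
      rw [map_sub, add_sub, hR, sub_self]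
    have h2 : α * ⟪v, v - w⟫_ℝ + ⟪T (v - w), v - w⟫_ℝ = 0 := by
      rw [← real_inner_smul_left, ← inner_add_left, h1, inner_zero_left]
    have h3 : ⟪v, v - w⟫_ℝ ≤ 0 := by
      by_contra! h
      nlinarith [hT (v - w), mul_pos hα h]
    rw [inner_sub_right, real_inner_self_eq_norm_sq] at h3
    have h4 := real_inner_le_norm v w
    simp only [ContinuousLinearEquiv.coe_coe, ← hv]
    rcases (norm_nonneg v).eq_or_lt with h0 | h0
    · rw [← h0]; exact norm_nonneg w
    · refine le_of_mul_le_mul_left ?_ h0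
      nlinarith

/-- Solvability of the projected Lavrent'ev equation for the quadratic operator `x ↦ B x x` with
an accretive derivative at `x₀`, under a source condition with a small source element `ω`. -/
theorem exists_projected_lavrentiev_solution (B : H →L[ℝ] H →L[ℝ] H)
    (hB : ∀ x y, ‖B x y‖ ≤ ‖x‖ * ‖y‖) (hsymm : ∀ x y, B x y = B y x) (x₀ : H)
    (hA : ∀ v, 0 ≤ ⟪(2 : ℝ) • B x₀ v, v⟫_ℝ) (X : Submodule ℝ H) [X.HasOrthogonalProjection]
    {α : ℝ} (hα : 0 < α) {ω κ ξ xref : H} (href : xref - x₀ = κ - (2 : ℝ) • B x₀ ω)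
    {s : ℝ} (hs0 : 0 ≤ s) (hs : s < 1 / 2)
    (hsmall : (α * ‖κ‖ + ‖ξ‖ + 2 * ‖x₀‖ * ‖x₀ - X.starProjection x₀‖
        + α * (2 * ‖x₀‖ * ‖ω - X.starProjection ω‖) + (s * α) ^ 2) / α + α * ‖ω‖
        + ‖x₀ - X.starProjection x₀‖ ≤ s * α) :
    ∃ x ∈ X, α • X.starProjection (xref - x) + X.starProjection (B x₀ x₀ + ξ)
        = X.starProjection (B (X.starProjection x) (X.starProjection x)) ∧
      ‖x₀ - x‖ ≤ s * α := by
  set Q := X.starProjection with hQ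
  set A : H →L[ℝ] H := (2 : ℝ) • B x₀ with hAdef
  have hAv : ∀ v, A v = (2 : ℝ) • B x₀ v := fun v => rfl
  have hAn : ∀ v, ‖A v‖ ≤ 2 * ‖x₀‖ * ‖v‖ := fun v => by
    rw [hAv, norm_smul, Real.norm_ofNat, mul_assoc]
    exact mul_le_mul_of_nonneg_left (hB _ _) zero_le_two
  have hQn : ∀ v, ‖Q v‖ ≤ ‖v‖ := fun v => X.norm_starProjection_apply_le v
  have hQX : ∀ v, Q v ∈ X := fun v => X.starProjection_apply_mem v
  have hQid : ∀ v ∈ X, Q v = v := fun v hv => Submodule.starProjection_eq_self_iff.2 hv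
  set T : H →L[ℝ] H := Q.comp (A.comp Q) with hTdef
  have hTv : ∀ v, T v = Q (A (Q v)) := fun v => rfl
  have hT : ∀ v, 0 ≤ ⟪T v, v⟫_ℝ := fun v => by
    rw [hTv, hQ, Submodule.inner_starProjection_left_eq_right]
    exact hA _
  obtain ⟨R, hR, hRn, hRT⟩ := exists_resolvent T hT hα
  -- `R g = α⁻¹ (g - T R g)` and `T` takes values in `X`.
  have hRX : ∀ g ∈ X, R g ∈ X := fun g hg => by
    have h1 : α • R g = g - T (R g) := eq_sub_of_add_eq (hR g)
    have h2 : R g = α⁻¹ • (g - T (R g)) := by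
      rw [← h1, smul_smul, inv_mul_cancel₀ hα.ne', one_smul]
    rw [h2]
    exact X.smul_mem _ (X.sub_mem hg (hQX _))
  set p := x₀ - Q x₀ with hp
  set q := ω - Q ω with hq
  -- All data of the equation except the quadratic remainder and `α T ω`. The term `A q` is the part
  -- of `A ω` missed by `A Q ω`, so that `Q A ω = T ω + Q A q`.
  set g₀ := α • κ + ξ + A p - α • A q with hg₀
  have hg₀n : ‖g₀‖ ≤ α * ‖κ‖ + ‖ξ‖ + 2 * ‖x₀‖ * ‖p‖ + α * (2 * ‖x₀‖ * ‖q‖) := by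
    refine (norm_sub_le _ _).trans (add_le_add ((norm_add_le _ _).trans
      (add_le_add ((norm_add_le _ _).trans (add_le_add ?_ le_rfl)) (hAn p))) ?_)
    · rw [norm_smul, Real.norm_of_nonneg hα.le]
    · rw [norm_smul, Real.norm_of_nonneg hα.le]
      exact mul_le_mul_of_nonneg_left (hAn q) hα.le
  -- In this map `z - p` stands for the error `x - x₀`, so the ball about `p` is an error ball.
  set Φ : H → H := fun z => R (Q (g₀ - B (z - p) (z - p))) - α • R (T ω) with hΦ
  have hmaps : MapsTo Φ (Metric.closedBall p (s * α)) (Metric.closedBall p (s * α)) := by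
    intro z hz
    rw [Metric.mem_closedBall, dist_eq_norm] at hz ⊢
    have h1 : ‖Q (g₀ - B (z - p) (z - p))‖
        ≤ α * ‖κ‖ + ‖ξ‖ + 2 * ‖x₀‖ * ‖p‖ + α * (2 * ‖x₀‖ * ‖q‖) + (s * α) ^ 2 := by
      refine (hQn _).trans ((norm_sub_le _ _).trans (add_le_add hg₀n ?_))
      refine (hB _ _).trans ?_
      rw [sq]
      exact mul_le_mul hz hz (norm_nonneg _) (by positivity)
    have h2 := (hRn (Q (g₀ - B (z - p) (z - p)))).trans (div_le_div_of_nonneg_right h1 hα.le)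
    have h3 : ‖α • R (T ω)‖ ≤ α * ‖ω‖ := by
      rw [norm_smul, Real.norm_of_nonneg hα.le]
      exact mul_le_mul_of_nonneg_left (hRT ω) hα.le
    calc ‖Φ z - p‖ ≤ ‖R (Q (g₀ - B (z - p) (z - p)))‖ + ‖α • R (T ω)‖ + ‖p‖ :=
          (norm_sub_le _ _).trans (add_le_add (norm_sub_le _ _) le_rfl)
      _ ≤ _ := add_le_add (add_le_add h2 h3) le_rfl
      _ ≤ s * α := hsmall
  have hcontr : ContractingWith (2 * s).toNNReal (hmaps.restrict Φ _ _) := by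
    refine ⟨by rw [← Real.toNNReal_one, Real.toNNReal_lt_toNNReal_iff one_pos]; linarith,
      LipschitzWith.of_dist_le_mul fun z z' => ?_⟩
    have hz := z.2
    have hz' := z'.2
    rw [Metric.mem_closedBall, dist_eq_norm] at hz hz'
    rw [Subtype.dist_eq, Subtype.dist_eq, MapsTo.val_restrict_apply, MapsTo.val_restrict_apply,
      dist_eq_norm, dist_eq_norm, Real.coe_toNNReal _ (by positivity)]
    generalize (z : H) = z at hz
    generalize (z' : H) = z' at hz'
    -- Difference of squares for the symmetric form `B`. The second factor is at most `2 s α`, which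
    -- cancels the `1/α` of `R` and leaves the constant `2 s`.
    have h1 : Φ z - Φ z' = R (Q (B (z' - z) ((z - p) + (z' - p)))) := by
      simp only [hΦ]
      rw [sub_sub_sub_cancel_right, ← map_sub, ← map_sub]
      congr 2
      have h2 : z' - z = (z' - p) - (z - p) := by abel
      rw [h2]
      generalize z - p = u
      generalize z' - p = u'
      rw [map_sub, sub_apply, map_add, map_add, hsymm u' u]
      abel
    rw [h1]
    refine (hRn _).trans ?_
    rw [div_le_iff₀ hα]
    refine ((hQn _).trans (hB _ _)).trans ?_
    rw [norm_sub_rev z' z]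
    have h3 : ‖(z - p) + (z' - p)‖ ≤ 2 * s * α := (norm_add_le _ _).trans (by linarith)
    nlinarith [norm_nonneg (z - z')]
  obtain ⟨z, hz, hfix, -⟩ := hcontr.exists_fixedPoint' Metric.isClosed_closedBall.isComplete hmaps
    (Metric.mem_closedBall_self (by positivity)) (edist_ne_top p _)
  have hΦz : Φ z = z := hfix
  have hzX : z ∈ X := by
    rw [← hΦz]
    exact X.sub_mem (hRX _ (hQX _)) (X.smul_mem _ (hRX _ (hQX _)))
  have hx : x₀ + (z - p) ∈ X := by
    have : x₀ + (z - p) = Q x₀ + z := by rw [hp]; abel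
    rw [this]
    exact X.add_mem (hQX _) hzX
  refine ⟨x₀ + (z - p), hx, ?_, ?_⟩
  · have heq : α • z + T z = Q (g₀ - B (z - p) (z - p)) - α • T ω := by
      have h1 := hR (Q (g₀ - B (z - p) (z - p)))
      have h2 := hR (T ω)
      have h3 : α • Φ z + T (Φ z) = Q (g₀ - B (z - p) (z - p)) - α • T ω := by
        conv_rhs => rw [← h1, ← h2]
        simp only [hΦ]
        rw [smul_sub, map_sub T, map_smul T, smul_add]
        abel
      rwa [hΦz] at h3
    rw [hQid _ hx]
    have h1 : xref - (x₀ + (z - p)) = κ - A ω - (z - p) := by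
      rw [← sub_sub, href, hAv]
    have h2 : B (x₀ + (z - p)) (x₀ + (z - p))
        = B x₀ x₀ + A (z - p) + B (z - p) (z - p) := by
      generalize z - p = u
      rw [map_add B, add_apply, map_add, map_add, hsymm u x₀, hAv, two_smul]
      abel
    have hQp : Q p = 0 := by
      rw [hp, map_sub, hQid _ (hQX _), sub_self]
    have hω : ω = Q ω + q := by rw [hq]; abel
    have h3 : Q (A ω) = Q (A (Q ω)) + Q (A q) := by
      conv_lhs => rw [hω]
      rw [map_add, map_add]
    rw [h1, h2]
    rw [hTv, hTv, hQid z hzX] at heq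
    generalize B (z - p) (z - p) = b at heq
    simp only [hg₀, map_sub, map_add, map_smul, hQp, hQid z hzX, h3, smul_sub, smul_add,
      smul_zero] at heq ⊢
    rw [eq_sub_of_add_eq heq]
    abel
  · rw [sub_add_cancel_left, norm_neg, ← dist_eq_norm]
    exact hz

end Abstract

/-! ### Classes and norms in the weighted space -/

theorem ae_unitVol_iff {p : ℝ → Prop} :
    (∀ᵐ t ∂unitVol, p t) ↔ ∀ᵐ t : ℝ, t ∈ Ioo (0 : ℝ) 1 → p t :=
  ae_restrict_iff' measurableSet_Ioo

/-- The weight is bounded above and below on `(0,1)`, so both measures have the same null sets. All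
later almost-everywhere arguments use the unweighted one. -/
theorem ae_weightedVol_eq (σ : ℝ) : ae (weightedVol σ) = ae unitVol :=
  le_antisymm ((Measure.absolutelyContinuous_of_le_smul (weightedVol_le σ)).ae_le)
    ((Measure.absolutelyContinuous_of_le_smul (unitVol_le σ)).ae_le)

theorem coeFn_toWL2 (σ : ℝ) {f : ℝ → ℝ} (hf : MemLp f 2 unitVol) :
    toWL2 σ f hf =ᵐ[unitVol] f := by
  have h := ((memLp_weightedVol_iff σ f).2 hf).coeFn_toLp
  rw [Filter.EventuallyEq, ae_weightedVol_eq] at h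
  exact h

theorem WeightedL2.ext_ae {σ : ℝ} {x y : WeightedL2 σ} (h : x =ᵐ[unitVol] y) : x = y := by
  apply Lp.ext
  rw [Filter.EventuallyEq, ae_weightedVol_eq]
  exact h

theorem WeightedL2.memLp {σ : ℝ} (x : WeightedL2 σ) : MemLp x 2 unitVol :=
  (memLp_weightedVol_iff σ x).1 (Lp.memLp x)

theorem toWL2_eq_iff {σ : ℝ} {f g : ℝ → ℝ} (hf : MemLp f 2 unitVol) (hg : MemLp g 2 unitVol) :
    toWL2 σ f hf = toWL2 σ g hg ↔ f =ᵐ[unitVol] g := by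
  rw [toWL2, toWL2, MemLp.toLp_eq_toLp_iff, Filter.EventuallyEq, ae_weightedVol_eq]
  rfl

theorem toWL2_coeFn {σ : ℝ} (x : WeightedL2 σ) : toWL2 σ x x.memLp = x :=
  WeightedL2.ext_ae (coeFn_toWL2 σ _)

theorem toWL2_add {σ : ℝ} {f g : ℝ → ℝ} (hf : MemLp f 2 unitVol) (hg : MemLp g 2 unitVol) :
    toWL2 σ f hf + toWL2 σ g hg = toWL2 σ (fun t => f t + g t) (hf.add hg) := rfl

theorem toWL2_sub {σ : ℝ} {f g : ℝ → ℝ} (hf : MemLp f 2 unitVol) (hg : MemLp g 2 unitVol) :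
    toWL2 σ f hf - toWL2 σ g hg = toWL2 σ (fun t => f t - g t) (hf.sub hg) := rfl

theorem smul_toWL2 {σ : ℝ} (a : ℝ) {f : ℝ → ℝ} (hf : MemLp f 2 unitVol) :
    a • toWL2 σ f hf = toWL2 σ (fun t => a * f t) (hf.const_smul a) := rfl

theorem coeFn_add {σ : ℝ} (x y : WeightedL2 σ) :
    (x + y : WeightedL2 σ) =ᵐ[unitVol] fun t => x t + y t := by
  have h := Lp.coeFn_add x y
  rw [Filter.EventuallyEq, ae_weightedVol_eq] at h
  exact h

theorem coeFn_smul {σ : ℝ} (a : ℝ) (x : WeightedL2 σ) :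
    (a • x : WeightedL2 σ) =ᵐ[unitVol] fun t => a * x t := by
  have h := Lp.coeFn_smul a x
  rw [Filter.EventuallyEq, ae_weightedVol_eq] at h
  exact h

theorem sq_integral_mul_le {α : Type*} [MeasurableSpace α] {μ : Measure α} {f g : α → ℝ}
    (hf : MemLp f 2 μ) (hg : MemLp g 2 μ) :
    (∫ t, f t * g t ∂μ) ^ 2 ≤ (∫ t, f t ^ 2 ∂μ) * ∫ t, g t ^ 2 ∂μ := by
  have key : ∀ {u v : α → ℝ} (hu : MemLp u 2 μ) (hv : MemLp v 2 μ),
      ⟪hu.toLp u, hv.toLp v⟫_ℝ = ∫ t, u t * v t ∂μ := fun hu hv => by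
    rw [L2.inner_def]
    refine integral_congr_ae ?_
    filter_upwards [hu.coeFn_toLp, hv.coeFn_toLp] with t h1 h2
    rw [h1, h2, Real.inner_apply, mul_comm]
  have h := real_inner_mul_inner_self_le (hf.toLp f) (hg.toLp g)
  rw [key, key, key] at h
  simpa only [sq] using h

theorem norm_sq_eq_integral {σ : ℝ} (x : WeightedL2 σ) :
    ‖x‖ ^ 2 = ∫ t in Ioo (0 : ℝ) 1, Real.exp (-(2 * σ * t)) * x t ^ 2 := by
  rw [← real_inner_self_eq_norm_sq, L2.inner_def]
  change ∫ t, ⟪x t, x t⟫_ℝ ∂(unitVol.withDensity fun t => ENNReal.ofReal _) = _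
  rw [integral_withDensity_eq_integral_toReal_smul (by fun_prop) (by simp)]
  refine integral_congr_ae (Filter.Eventually.of_forall fun t => ?_)
  simp only [ENNReal.toReal_ofReal (Real.exp_pos _).le, smul_eq_mul, Real.inner_apply, sq]

theorem norm_toWL2_sq (σ : ℝ) {f : ℝ → ℝ} (hf : MemLp f 2 unitVol) :
    ‖toWL2 σ f hf‖ ^ 2 = ∫ t in Ioo (0 : ℝ) 1, Real.exp (-(2 * σ * t)) * f t ^ 2 := by
  rw [norm_sq_eq_integral]
  refine integral_congr_ae ?_
  filter_upwards [coeFn_toWL2 σ hf] with t ht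
  rw [ht]

/-! ### Volterra convolution as a bounded bilinear map -/

theorem measurePreserving_reflect (s : ℝ) :
    MeasurePreserving (fun t => s - t) (volume.restrict (Ioo 0 s)) (volume.restrict (Ioo 0 s)) := by
  have h := (Measure.measurePreserving_sub_left volume s).restrict_preimage
    (measurableSet_Ioo (a := 0) (b := s))
  simpa using h

theorem memLp_of_mem_Icc {p : ℝ≥0∞} {x : ℝ → ℝ} (hx : MemLp x p unitVol) {s : ℝ} (hs : s ≤ 1) :
    MemLp x p (volume.restrict (Ioo 0 s)) :=
  hx.mono_measure (Measure.restrict_mono (Ioo_subset_Ioo_right hs) le_rfl)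

theorem memLp_reflect {p : ℝ≥0∞} {x : ℝ → ℝ} (hx : MemLp x p unitVol) {s : ℝ} (hs : s ≤ 1) :
    MemLp (fun t => x (s - t)) p (volume.restrict (Ioo 0 s)) :=
  (memLp_of_mem_Icc hx hs).comp_measurePreserving (measurePreserving_reflect s)

theorem conv_eq_setIntegral (x y : ℝ → ℝ) {s : ℝ} (hs : 0 ≤ s) :
    conv x y s = ∫ t in Ioo 0 s, x (s - t) * y t := by
  rw [conv, intervalIntegral.integral_of_le hs, integral_Ioc_eq_integral_Ioo]

theorem conv_comm (x y : ℝ → ℝ) (s : ℝ) : conv x y s = conv y x s := by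
  rw [conv, conv]
  have h := intervalIntegral.integral_comp_sub_left (a := 0) (b := s) (fun t => x (s - t) * y t) s
  simp only [sub_sub_cancel, sub_self, sub_zero] at h
  rw [← h]
  simp only [mul_comm]

/-- Valid at every `s`, not merely almost every one, because `t ↦ s - t` preserves Lebesgue measure
on `(0,s)`. Representatives can therefore be exchanged inside pointwise identities. -/
theorem conv_congr {x x' y y' : ℝ → ℝ} (hx : x =ᵐ[unitVol] x') (hy : y =ᵐ[unitVol] y') {s : ℝ}
    (hs : s ∈ Icc (0 : ℝ) 1) : conv x y s = conv x' y' s := by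
  rw [conv_eq_setIntegral _ _ hs.1, conv_eq_setIntegral _ _ hs.1]
  have hle : ae (volume.restrict (Ioo 0 s)) ≤ ae unitVol :=
    ae_mono (Measure.restrict_mono (Ioo_subset_Ioo_right hs.2) le_rfl)
  refine integral_congr_ae ?_
  filter_upwards [(measurePreserving_reflect s).quasiMeasurePreserving.ae (hx.filter_mono hle),
    hy.filter_mono hle] with t h1 h2
  rw [h1, h2]

theorem conv_integrable {x y : ℝ → ℝ} (hx : MemLp x 2 unitVol) (hy : MemLp y 2 unitVol) {s : ℝ}
    (hs : s ≤ 1) : IntegrableOn (fun t => x (s - t) * y t) (Ioo 0 s) :=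
  (memLp_reflect hx hs).integrable_mul (memLp_of_mem_Icc hy hs)

theorem conv_add_right {x y z : ℝ → ℝ} (hx : MemLp x 2 unitVol) (hy : MemLp y 2 unitVol)
    (hz : MemLp z 2 unitVol) {s : ℝ} (hs : s ∈ Icc (0 : ℝ) 1) :
    conv x (fun t => y t + z t) s = conv x y s + conv x z s := by
  rw [conv_eq_setIntegral _ _ hs.1, conv_eq_setIntegral _ _ hs.1, conv_eq_setIntegral _ _ hs.1,
    ← integral_add (conv_integrable hx hy hs.2) (conv_integrable hx hz hs.2)]
  simp only [mul_add]

theorem conv_const_mul_right (x y : ℝ → ℝ) (a s : ℝ) :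
    conv x (fun t => a * y t) s = a * conv x y s := by
  rw [conv, conv, ← intervalIntegral.integral_const_mul]
  simp only [mul_left_comm]

/-- The weight splits, `e^{-σs} = e^{-σ(s-t)} e^{-σt}`, so the weighted convolution is the
convolution of the weighted factors; Cauchy-Schwarz on `(0,s)` finishes. -/
theorem sq_conv_le (σ : ℝ) {x y : ℝ → ℝ} (hx : MemLp x 2 unitVol) (hy : MemLp y 2 unitVol)
    {s : ℝ} (hs : s ∈ Icc (0 : ℝ) 1) :
    Real.exp (-(2 * σ * s)) * conv x y s ^ 2 ≤ ‖toWL2 σ x hx‖ ^ 2 * ‖toWL2 σ y hy‖ ^ 2 := by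
  have hw : ∀ {x : ℝ → ℝ}, MemLp x 2 unitVol →
      MemLp (fun t => Real.exp (-(σ * t)) * x t) 2 unitVol := fun {x} hx => by
    have h : MemLp (fun t => Real.exp (-(σ * t))) ∞ unitVol := by
      refine MemLp.of_bound (by fun_prop) (Real.exp |σ|) ?_
      rw [ae_unitVol_iff]
      refine Filter.Eventually.of_forall fun t ht => ?_
      rw [Real.norm_of_nonneg (Real.exp_pos _).le]
      refine Real.exp_le_exp.2 ?_
      nlinarith [neg_le_abs σ, abs_nonneg σ, ht.1, ht.2]
    exact hx.mul (r := 2) h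
  have hexp : ∀ t : ℝ, Real.exp (-(σ * t)) ^ 2 = Real.exp (-(2 * σ * t)) := fun t => by
    rw [← Real.exp_nat_mul]
    congr 1
    push_cast
    ring
  have h1 : Real.exp (-(2 * σ * s)) * conv x y s ^ 2
      = (∫ t in Ioo 0 s, (Real.exp (-(σ * (s - t))) * x (s - t)) * (Real.exp (-(σ * t)) * y t)) ^ 2
      := by
    rw [← hexp, ← mul_pow, conv_eq_setIntegral _ _ hs.1, ← integral_const_mul]
    congr 2
    funext t
    have : Real.exp (-(σ * s)) = Real.exp (-(σ * (s - t))) * Real.exp (-(σ * t)) := by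
      rw [← Real.exp_add]
      congr 1
      ring
    rw [this]
    ring
  have hmono : ∀ {x : ℝ → ℝ} (hx : MemLp x 2 unitVol),
      ∫ t in Ioo 0 s, (Real.exp (-(σ * t)) * x t) ^ 2 ≤ ‖toWL2 σ x hx‖ ^ 2 := fun hx => by
    rw [norm_toWL2_sq]
    simp only [mul_pow, hexp]
    refine setIntegral_mono_set ?_ (Filter.Eventually.of_forall fun t => by positivity)
      (Ioo_subset_Ioo_right hs.2).eventuallyLE
    have h := (hw hx).integrable_sq
    simp only [mul_pow, hexp] at h
    exact h
  rw [h1]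
  refine (sq_integral_mul_le (memLp_reflect (hw hx) hs.2)
    (memLp_of_mem_Icc (hw hy) hs.2)).trans ?_
  refine mul_le_mul ?_ (hmono hy) (integral_nonneg fun t => sq_nonneg _) (sq_nonneg _)
  refine le_trans (le_of_eq ?_) (hmono hx)
  rw [← integral_Ioc_eq_integral_Ioo, ← integral_Ioc_eq_integral_Ioo,
    ← intervalIntegral.integral_of_le hs.1, ← intervalIntegral.integral_of_le hs.1]
  have h := intervalIntegral.integral_comp_sub_left (a := 0) (b := s)
    (fun t => (Real.exp (-(σ * t)) * x t) ^ 2) s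
  simpa using h

theorem norm_convWL2_le {σ : ℝ} (x y : WeightedL2 σ) : ‖convWL2 x y‖ ≤ ‖x‖ * ‖y‖ := by
  refine le_of_sq_le_sq ?_ (by positivity)
  rw [convWL2, norm_toWL2_sq, mul_pow]
  have hfin : volume (Ioo (0 : ℝ) 1) ≠ ∞ := by simp
  have h : ∀ s ∈ Ioo (0 : ℝ) 1, Real.exp (-(2 * σ * s)) * conv x y s ^ 2 ≤ ‖x‖ ^ 2 * ‖y‖ ^ 2 := by
    intro s hs
    have := sq_conv_le σ x.memLp y.memLp (Ioo_subset_Icc_self hs)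
    rwa [toWL2_coeFn, toWL2_coeFn] at this
  have h2 : ∫ s in Ioo (0 : ℝ) 1, Real.exp (-(2 * σ * s)) * conv x y s ^ 2
      ≤ ∫ s in Ioo (0 : ℝ) 1, ‖x‖ ^ 2 * ‖y‖ ^ 2 := by
    refine integral_mono_of_nonneg (Filter.Eventually.of_forall fun t => by positivity)
      (integrable_const _) ?_
    filter_upwards [ae_restrict_mem measurableSet_Ioo] with s hs using h s hs
  simpa using h2

theorem convWL2_toWL2 {σ : ℝ} {f g : ℝ → ℝ} (hf : MemLp f 2 unitVol) (hg : MemLp g 2 unitVol) :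
    convWL2 (toWL2 σ f hf) (toWL2 σ g hg) = toWL2 σ (conv f g) (conv_memLp hf hg) := by
  rw [convWL2, toWL2_eq_iff, Filter.EventuallyEq, ae_unitVol_iff]
  exact Filter.Eventually.of_forall fun s hs =>
    conv_congr (coeFn_toWL2 σ hf) (coeFn_toWL2 σ hg) (Ioo_subset_Icc_self hs)

theorem convWL2_comm {σ : ℝ} (x y : WeightedL2 σ) : convWL2 x y = convWL2 y x := by
  rw [convWL2, convWL2, toWL2_eq_iff]
  exact Filter.Eventually.of_forall fun s => conv_comm x y s

theorem convWL2_add_right {σ : ℝ} (x y z : WeightedL2 σ) :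
    convWL2 x (y + z) = convWL2 x y + convWL2 x z := by
  rw [convWL2, convWL2, convWL2, toWL2_add, toWL2_eq_iff, Filter.EventuallyEq, ae_unitVol_iff]
  refine Filter.Eventually.of_forall fun s hs => ?_
  have hs' := Ioo_subset_Icc_self hs
  rw [conv_congr Filter.EventuallyEq.rfl (coeFn_add y z) hs',
    conv_add_right x.memLp y.memLp z.memLp hs']

theorem convWL2_smul_right {σ : ℝ} (a : ℝ) (x y : WeightedL2 σ) :
    convWL2 x (a • y) = a • convWL2 x y := by
  rw [convWL2, convWL2, smul_toWL2, toWL2_eq_iff, Filter.EventuallyEq, ae_unitVol_iff]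
  refine Filter.Eventually.of_forall fun s hs => ?_
  rw [conv_congr Filter.EventuallyEq.rfl (coeFn_smul a y) (Ioo_subset_Icc_self hs),
    conv_const_mul_right]

/-- The Volterra convolution as a bounded bilinear map. -/
def convCLM (σ : ℝ) : WeightedL2 σ →L[ℝ] WeightedL2 σ →L[ℝ] WeightedL2 σ :=
  LinearMap.mkContinuous₂ (LinearMap.mk₂ ℝ convWL2
    (fun x y z => by rw [convWL2_comm, convWL2_add_right, convWL2_comm z x, convWL2_comm z y])
    (fun a x y => by rw [convWL2_comm, convWL2_smul_right, convWL2_comm y x])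
    convWL2_add_right (fun a x y => convWL2_smul_right a x y)) 1
    (fun x y => by rw [one_mul]; exact norm_convWL2_le x y)

theorem convCLM_apply {σ : ℝ} (x y : WeightedL2 σ) : convCLM σ x y = convWL2 x y := rfl

/-! ### Weak derivatives and the regularity of the exact solution -/

/-- A smooth function supported in `(0,1)`. -/
structure IsTestFunction (φ : ℝ → ℝ) : Prop where
  contDiff : ContDiff ℝ (⊤ : ℕ∞) φ
  hasCompactSupport : HasCompactSupport φ
  tsupport_subset : tsupport φ ⊆ Ioo 0 1

theorem IsTestFunction.eq_zero {φ : ℝ → ℝ} (hφ : IsTestFunction φ) {t : ℝ} (ht : t ∉ Ioo (0 : ℝ) 1) :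
    φ t = 0 :=
  image_eq_zero_of_notMem_tsupport fun h => ht (hφ.tsupport_subset h)

theorem IsTestFunction.integrable_mul {φ u : ℝ → ℝ} (hφ : IsTestFunction φ)
    (hu : IntegrableOn u (Ioo 0 1)) : IntegrableOn (fun t => u t * φ t) (Ioo 0 1) := by
  obtain ⟨C, hC⟩ := hφ.hasCompactSupport.exists_bound_of_continuous hφ.contDiff.continuous
  exact Integrable.mul_bdd hu hφ.contDiff.continuous.aestronglyMeasurable
    (Filter.Eventually.of_forall hC)

theorem IsTestFunction.deriv {φ : ℝ → ℝ} (hφ : IsTestFunction φ) : IsTestFunction (deriv φ) where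
  contDiff := (contDiff_infty_iff_deriv.1 hφ.contDiff).2
  hasCompactSupport := hφ.hasCompactSupport.deriv
  tsupport_subset := (tsupport_deriv_subset).trans hφ.tsupport_subset

theorem exists_Icc_of_isCompact_subset_Ioo {K : Set ℝ} (hK : IsCompact K) (h : K ⊆ Ioo 0 1) :
    ∃ a b : ℝ, 0 < a ∧ b < 1 ∧ K ⊆ Icc a b := by
  rcases K.eq_empty_or_nonempty with rfl | hne
  · exact ⟨1, 0, one_pos, one_pos, empty_subset _⟩
  · obtain ⟨a, ha⟩ := hK.exists_isLeast hne
    obtain ⟨b, hb⟩ := hK.exists_isGreatest hne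
    exact ⟨a, b, (h ha.1).1, (h hb.1).2, fun t ht => ⟨ha.2 ht, hb.2 ht⟩⟩

/-- A test function of mean zero is the derivative of a test function. -/
theorem IsTestFunction.exists_deriv_eq {χ : ℝ → ℝ} (hχ : IsTestFunction χ)
    (h0 : ∫ t in Ioo (0 : ℝ) 1, χ t = 0) : ∃ φ, IsTestFunction φ ∧ _root_.deriv φ = χ := by
  have hc := hχ.contDiff.continuous
  have hd : ∀ t, HasDerivAt (fun t => ∫ s in (0 : ℝ)..t, χ s) (χ t) t := fun t =>
    intervalIntegral.integral_hasDerivAt_right (hc.intervalIntegrable _ _)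
      (hc.stronglyMeasurableAtFilter _ _) hc.continuousAt
  have hderiv : _root_.deriv (fun t => ∫ s in (0 : ℝ)..t, χ s) = χ := funext fun t => (hd t).deriv
  obtain ⟨a, b, ha, hb, hab⟩ := exists_Icc_of_isCompact_subset_Ioo hχ.hasCompactSupport
    hχ.tsupport_subset
  have hz : ∀ t, t ∉ Icc a b → χ t = 0 := fun t ht =>
    image_eq_zero_of_notMem_tsupport fun h => ht (hab h)
  have hsupp : Function.support (fun t => ∫ s in (0 : ℝ)..t, χ s) ⊆ Icc a b := by
    intro t ht
    by_contra hn
    refine ht ?_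
    rw [mem_Icc, not_and_or, not_le, not_le] at hn
    have h01 : ∫ s in (0 : ℝ)..1, χ s = 0 := by
      rw [intervalIntegral.integral_of_le zero_le_one, integral_Ioc_eq_integral_Ioo, h0]
    have hvan : ∀ c d : ℝ, (∀ s ∈ uIcc c d, s ∉ Icc a b) → ∫ s in c..d, χ s = 0 := by
      intro c d h
      rw [intervalIntegral.integral_congr (g := fun _ => 0) fun s hs => hz s (h s hs)]
      simp
    rcases hn with hn | hn
    · refine hvan 0 t fun s hs hs' => ?_
      have := hs.2
      have h1 : max 0 t < a := max_lt ha hn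
      linarith [hs'.1]
    -- To the right of the support the primitive equals the total integral, which is zero by the
    -- mean-zero hypothesis.
    · have h1 : ∫ s in (1 : ℝ)..t, χ s = 0 := by
        refine hvan 1 t fun s hs hs' => ?_
        have h1 : b < min 1 t := lt_min hb hn
        have := hs.1
        linarith [hs'.2]
      have h2 := intervalIntegral.integral_add_adjacent_intervals
        (hc.intervalIntegrable (μ := volume) 0 1) (hc.intervalIntegrable 1 t)
      rw [h01, h1, add_zero] at h2
      exact h2.symm
  refine ⟨_, ⟨?_, HasCompactSupport.of_support_subset_isCompact isCompact_Icc hsupp, ?_⟩, hderiv⟩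
  · rw [contDiff_infty_iff_deriv, hderiv]
    exact ⟨fun t => (hd t).differentiableAt, hχ.contDiff⟩
  · exact (closure_minimal hsupp isClosed_Icc).trans
      fun t ht => ⟨ha.trans_le ht.1, ht.2.trans_lt hb⟩

/-- The lemma of du Bois-Reymond. -/
theorem ae_eq_const_of_integral_mul_deriv_eq_zero {u : ℝ → ℝ} (hu : IntegrableOn u (Ioo 0 1))
    (h : ∀ φ, IsTestFunction φ → ∫ t in Ioo (0 : ℝ) 1, u t * deriv φ t = 0) :
    ∃ C, ∀ᵐ t, t ∈ Ioo (0 : ℝ) 1 → u t = C := by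
  obtain ⟨ψ, hψ1, hψ2, hψ3, hψ4, hψ5⟩ := exists_contDiff_tsupport_subset (n := ⊤)
    (isOpen_Ioo.mem_nhds (show (1 / 2 : ℝ) ∈ Ioo (0 : ℝ) 1 by norm_num))
  have hψ : IsTestFunction ψ := ⟨hψ3, hψ2, hψ1⟩
  have hfull : ∀ {φ : ℝ → ℝ}, (∀ t, t ∉ Ioo (0 : ℝ) 1 → φ t = 0) →
      ∫ t in Ioo (0 : ℝ) 1, φ t = ∫ t, φ t := fun hφ =>
    setIntegral_eq_integral_of_forall_compl_eq_zero hφ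
  set I := ∫ t in Ioo (0 : ℝ) 1, ψ t with hI
  have hIpos : 0 < I := by
    rw [hI, hfull fun t => hψ.eq_zero]
    exact hψ3.continuous.integral_pos_of_hasCompactSupport_nonneg_nonzero hψ2
      (fun t => (hψ4 ⟨t, rfl⟩).1) (x := 1 / 2) (by rw [hψ5]; exact one_ne_zero)
  set C := (∫ t in Ioo (0 : ℝ) 1, u t * ψ t) / I with hC
  refine ⟨C, ?_⟩
  have hv : IntegrableOn (fun t => u t - C) (Ioo 0 1) := hu.sub (integrableOn_const (by simp))
  have hone : IntegrableOn (fun _ : ℝ => (1 : ℝ)) (Ioo 0 1) := integrableOn_const (by simp)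
  have hmain := isOpen_Ioo.ae_eq_zero_of_integral_contDiff_smul_eq_zero
    (hv.locallyIntegrableOn) fun g hg1 hg2 hg3 => ?_
  · filter_upwards [hmain] with t ht h't
    exact sub_eq_zero.1 (ht h't)
  have hg : IsTestFunction g := ⟨hg1, hg2, hg3⟩
  rw [← hfull fun t ht => by rw [hg.eq_zero ht, zero_smul]]
  set J := ∫ t in Ioo (0 : ℝ) 1, g t with hJ
  have hgi : IntegrableOn g (Ioo 0 1) := by simpa using hg.integrable_mul hone
  have hψi : IntegrableOn ψ (Ioo 0 1) := by simpa using hψ.integrable_mul hone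
  -- Subtracting a multiple of the bump `ψ` makes an arbitrary test function mean zero, hence a
  -- derivative; `C` is the `ψ`-weighted mean of `u`.
  have hχ : IsTestFunction fun t => g t - J / I * ψ t := by
    refine ⟨hg1.sub (contDiff_const.mul hψ3), hg2.sub (hψ2.mul_left), ?_⟩
    refine (closure_mono ?_).trans (closure_union.trans_subset (union_subset hg3 hψ1))
    intro t ht
    by_contra hn
    rw [mem_union, not_or, Function.notMem_support, Function.notMem_support] at hn
    exact ht (by simp only [hn.1, hn.2, mul_zero, sub_zero])
  have hχ0 : ∫ t in Ioo (0 : ℝ) 1, (g t - J / I * ψ t) = 0 := by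
    rw [integral_sub hgi (hψi.const_mul _), integral_const_mul, ← hI, ← hJ,
      div_mul_cancel₀ _ hIpos.ne', sub_self]
  obtain ⟨φ, hφ, hφd⟩ := hχ.exists_deriv_eq hχ0
  have h1 := h φ hφ
  rw [hφd] at h1
  have e1 : ∀ t, u t * (g t - J / I * ψ t) = u t * g t - J / I * (u t * ψ t) := fun t => by ring
  have e2 : ∀ t, g t • (u t - C) = u t * g t - C * g t := fun t => by
    rw [smul_eq_mul]; ring
  simp only [e1] at h1
  simp only [e2]
  rw [integral_sub (hg.integrable_mul hu) ((hψ.integrable_mul hu).const_mul _),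
    integral_const_mul] at h1
  rw [integral_sub (hg.integrable_mul hu) (hgi.const_mul _), integral_const_mul, ← hJ, hC]
  linear_combination h1

/-- A function with an integrable weak derivative is the primitive of that derivative. -/
theorem HasWeakDeriv.exists_ae_eq_primitive {f g : ℝ → ℝ} (h : HasWeakDeriv f g)
    (hf : IntegrableOn f (Ioo 0 1)) (hg : IntegrableOn g (Ioo 0 1)) :
    ∃ C, ∀ᵐ t, t ∈ Ioo (0 : ℝ) 1 → f t = C + ∫ s in (0 : ℝ)..t, g s := by
  have hgi : IntervalIntegrable g volume 0 1 :=
    (intervalIntegrable_iff_integrableOn_Ioo_of_le zero_le_one).2 hg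
  have hG := hgi.absolutelyContinuousOnInterval_intervalIntegral (c := 0) (by simp)
  have hGi : IntegrableOn (fun t => ∫ s in (0 : ℝ)..t, g s) (Ioo 0 1) := by
    have := hG.continuousOn.integrableOn_compact (μ := volume) isCompact_uIcc
    rw [uIcc_of_le zero_le_one] at this
    exact this.mono_set Ioo_subset_Icc_self
  have key := ae_eq_const_of_integral_mul_deriv_eq_zero (hf.sub hGi) fun φ hφ => by
    have h1 := h.2.2 φ hφ.contDiff hφ.hasCompactSupport hφ.tsupport_subset
    -- Integration by parts for the absolutely continuous primitive; the boundary terms vanish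
    -- because `φ` does at both endpoints.
    have h2 := hG.integral_mul_deriv_eq_deriv_mul
      ((hφ.contDiff.of_le (by exact_mod_cast le_top)).contDiffOn.absolutelyContinuousOnInterval)
    rw [hφ.eq_zero (t := 0) (by simp), hφ.eq_zero (t := 1) (by simp), mul_zero, mul_zero, sub_zero,
      zero_sub] at h2
    have h3 : ∫ t in (0 : ℝ)..1, deriv (fun t => ∫ s in (0 : ℝ)..t, g s) t * φ t
        = ∫ t in (0 : ℝ)..1, g t * φ t := by
      refine intervalIntegral.integral_congr_ae ?_
      filter_upwards [hgi.ae_hasDerivAt_integral] with t ht h't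
      rw [(ht (uIoc_subset_uIcc h't) 0 (by simp)).deriv]
    rw [h3, intervalIntegral.integral_of_le zero_le_one,
      intervalIntegral.integral_of_le zero_le_one, integral_Ioc_eq_integral_Ioo,
      integral_Ioc_eq_integral_Ioo] at h2
    simp only [Pi.sub_apply, sub_mul]
    rw [integral_sub (hφ.deriv.integrable_mul hf) (hφ.deriv.integrable_mul hGi), h1, h2, sub_self]
  obtain ⟨C, hC⟩ := key
  refine ⟨C, ?_⟩
  filter_upwards [hC] with t ht h't
  have := ht h't
  rw [Pi.sub_apply] at this
  linarith

theorem exists_ae_bound {f : ℝ → ℝ} (hf : MemLp f ∞ unitVol) :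
    ∃ M : NNReal, ∀ᵐ t, t ∈ Ioo (0 : ℝ) 1 → ‖f t‖ ≤ M := by
  refine ⟨(eLpNorm f ∞ unitVol).toNNReal, ?_⟩
  rw [← ae_unitVol_iff]
  rw [eLpNorm_exponent_top]
  filter_upwards [ae_le_eLpNormEssSup (f := f) (μ := unitVol)] with t ht
  have hfin : eLpNormEssSup f unitVol ≠ ∞ := by
    rw [← eLpNorm_exponent_top]
    exact hf.2.ne
  have := ENNReal.toNNReal_mono hfin ht
  exact_mod_cast this

theorem ae_mem_Ioo_of_mem_Ioc {p : ℝ → Prop} (h : ∀ᵐ t, t ∈ Ioo (0 : ℝ) 1 → p t) :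
    ∀ᵐ t, t ∈ Ioc (0 : ℝ) 1 → p t := by
  rw [← ae_restrict_iff' measurableSet_Ioc, ← restrict_Ioo_eq_restrict_Ioc,
    ae_restrict_iff' measurableSet_Ioo]
  exact h

theorem lipschitzOnWith_primitive {f : ℝ → ℝ} {M : NNReal} (hf : IntegrableOn f (Ioo 0 1))
    (hM : ∀ᵐ t, t ∈ Ioo (0 : ℝ) 1 → ‖f t‖ ≤ M) (C : ℝ) :
    LipschitzOnWith M (fun t => C + ∫ s in (0 : ℝ)..t, f s) (Icc 0 1) := by
  have hfi : IntervalIntegrable f volume 0 1 :=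
    (intervalIntegrable_iff_integrableOn_Ioo_of_le zero_le_one).2 hf
  have hsub : ∀ {a b : ℝ}, a ∈ Icc (0 : ℝ) 1 → b ∈ Icc (0 : ℝ) 1 → uIcc a b ⊆ uIcc 0 1 :=
    fun ha hb => by
      rw [uIcc_of_le (zero_le_one' ℝ)]
      exact uIcc_subset_Icc ha hb
  refine LipschitzOnWith.of_dist_le_mul fun a ha b hb => ?_
  rw [dist_add_left, dist_eq_norm, Real.dist_eq, intervalIntegral.integral_interval_sub_left
    (hfi.mono_set (hsub (by simp) ha)) (hfi.mono_set (hsub (by simp) hb))]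
  refine intervalIntegral.norm_integral_le_of_norm_le_const_ae ?_
  filter_upwards [ae_mem_Ioo_of_mem_Ioc hM] with t ht h't
  refine ht ?_
  have h1 : 0 ≤ min b a := le_min hb.1 ha.1
  have h2 : max b a ≤ 1 := max_le hb.2 ha.2
  exact ⟨h1.trans_lt h't.1, h't.2.trans h2⟩

/-- A function in `W²_∞(0,1)` is the primitive of a Lipschitz function. -/
theorem SolutionSmoothness.exists_lipschitz_deriv {x₀ : ℝ → ℝ} (h : SolutionSmoothness x₀) :
    ∃ (K : NNReal) (k : ℝ → ℝ), LipschitzWith K k ∧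
      ∀ t ∈ Icc (0 : ℝ) 1, x₀ t = x₀ 0 + ∫ s in (0 : ℝ)..t, k s := by
  obtain ⟨h0, f₁, f₂, h1, h2, h01, h12⟩ := h.memW2Inf
  have i0 : IntegrableOn x₀ (Ioo 0 1) := h0.integrable le_top
  have i1 : IntegrableOn f₁ (Ioo 0 1) := h1.integrable le_top
  have i2 : IntegrableOn f₂ (Ioo 0 1) := h2.integrable le_top
  obtain ⟨M, hM⟩ := exists_ae_bound h2
  obtain ⟨C₁, hC₁⟩ := h12.exists_ae_eq_primitive i1 i2
  obtain ⟨C₀, hC₀⟩ := h01.exists_ae_eq_primitive i0 i1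
  -- The representative of `x₀'` is extended to a Lipschitz function on the whole line, so that
  -- continuity needs no restriction later.
  obtain ⟨k, hk, hkeq⟩ := (lipschitzOnWith_primitive i2 hM C₁).extend_real
  have hprim : ∀ t ∈ Icc (0 : ℝ) 1, ∫ s in (0 : ℝ)..t, f₁ s = ∫ s in (0 : ℝ)..t, k s := by
    intro t ht
    refine intervalIntegral.integral_congr_ae ?_
    filter_upwards [ae_mem_Ioo_of_mem_Ioc hC₁] with s hs h's
    rw [uIoc_of_le ht.1] at h's
    have hs1 : s ∈ Ioc (0 : ℝ) 1 := ⟨h's.1, h's.2.trans ht.2⟩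
    rw [hs hs1, ← hkeq (Ioc_subset_Icc_self hs1)]
  have hcont : Continuous fun t => C₀ + ∫ s in (0 : ℝ)..t, k s :=
    continuous_const.add (intervalIntegral.continuous_primitive
      (fun a b => hk.continuous.intervalIntegrable a b) 0)
  -- Continuity upgrades almost-everywhere equality to equality on all of `[0,1]`; its value at `0`
  -- identifies `C₀` with `x₀ 0`.
  have heq : EqOn x₀ (fun t => C₀ + ∫ s in (0 : ℝ)..t, k s) (Icc 0 1) := by
    refine Measure.eqOn_Icc_of_ae_eq volume zero_ne_one ?_ h.continuousOn hcont.continuousOn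
    rw [← restrict_Ioo_eq_restrict_Icc, Filter.EventuallyEq, ae_restrict_iff' measurableSet_Ioo]
    filter_upwards [hC₀] with t ht h't
    rw [ht h't, hprim t (Ioo_subset_Icc_self h't)]
  have hC : C₀ = x₀ 0 := by
    have := heq (left_mem_Icc.2 zero_le_one)
    simpa using this.symm
  refine ⟨M, k, hk, fun t ht => ?_⟩
  rw [← hC]
  exact heq ht

theorem memH1_of_lipschitzOnWith {f : ℝ → ℝ} {K : NNReal} (hf : LipschitzOnWith K f (Icc 0 1)) :
    MemH1 f where
  absolutelyContinuous := by
    refine LipschitzOnWith.absolutelyContinuousOnInterval (K := K) ?_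
    rwa [uIcc_of_le zero_le_one]
  deriv_memLp := by
    refine MemLp.of_bound (measurable_deriv f).aestronglyMeasurable K ?_
    rw [ae_unitVol_iff]
    exact Filter.Eventually.of_forall fun t ht =>
      norm_deriv_le_of_lipschitzOn (Icc_mem_nhds ht.1 ht.2) hf

/-! ### Volterra equations of the second kind -/

theorem integral_exp_neg_two_mul_le {τ : ℝ} (hτ : 0 < τ) :
    ∫ t in Ioo (0 : ℝ) 1, Real.exp (-(2 * τ * t)) ≤ 1 / (2 * τ) := by
  have hd : ∀ t : ℝ, HasDerivAt (fun t => -(1 / (2 * τ)) * Real.exp (-(2 * τ * t)))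
      (Real.exp (-(2 * τ * t))) t := fun t => by
    have h1 : HasDerivAt (fun t : ℝ => -(2 * τ * t)) (-(2 * τ)) t := by
      simpa using ((hasDerivAt_id' t).const_mul (2 * τ)).fun_neg
    have h2 := (h1.exp).const_mul (-(1 / (2 * τ)))
    refine h2.congr_deriv ?_
    field_simp
  rw [← integral_Ioc_eq_integral_Ioo, ← intervalIntegral.integral_of_le zero_le_one,
    intervalIntegral.integral_eq_sub_of_hasDerivAt (fun t _ => hd t)
      (Continuous.intervalIntegrable (by fun_prop) _ _)]
  have h3 : 0 < 1 / (2 * τ) * Real.exp (-(2 * τ * 1)) := by positivity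
  simp only [mul_zero, neg_zero, Real.exp_zero]
  linarith

/-- Used to make a bounded kernel small in norm by taking the weight exponent `τ` large; this `τ` is
unrelated to `σ`. -/
theorem norm_toWL2_sq_le {τ M : ℝ} (hτ : 0 < τ) {f : ℝ → ℝ}
    (hf : MemLp f 2 unitVol) (hM : ∀ t ∈ Icc (0 : ℝ) 1, |f t| ≤ M) :
    ‖toWL2 τ f hf‖ ^ 2 ≤ M ^ 2 / (2 * τ) := by
  rw [norm_toWL2_sq, div_eq_mul_one_div, ← mul_one_div]
  have hi : IntegrableOn (fun t => M ^ 2 * Real.exp (-(2 * τ * t))) (Ioo 0 1) :=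
    (Continuous.integrableOn_Icc (by fun_prop)).mono_set Ioo_subset_Icc_self
  calc ∫ t in Ioo (0 : ℝ) 1, Real.exp (-(2 * τ * t)) * f t ^ 2
      ≤ ∫ t in Ioo (0 : ℝ) 1, M ^ 2 * Real.exp (-(2 * τ * t)) := by
        refine integral_mono_of_nonneg (Filter.Eventually.of_forall fun t => by positivity) hi ?_
        filter_upwards [ae_restrict_mem measurableSet_Ioo] with t ht
        have h1 : f t ^ 2 ≤ M ^ 2 := sq_le_sq' (abs_le.1 (hM t (Ioo_subset_Icc_self ht))).1
          (abs_le.1 (hM t (Ioo_subset_Icc_self ht))).2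
        nlinarith [Real.exp_pos (-(2 * τ * t))]
    _ ≤ _ := by
        rw [integral_const_mul, mul_one_div]
        exact (mul_le_mul_of_nonneg_left (integral_exp_neg_two_mul_le hτ) (sq_nonneg M)).trans
          (by rw [mul_one_div])

/-- Solvability in `L₂(0,1)` of a Volterra convolution equation of the second kind. -/
theorem exists_memLp_volterra {a M : ℝ} (ha : 0 < a) {k g : ℝ → ℝ} (hk : MemLp k 2 unitVol)
    (hM : ∀ t ∈ Icc (0 : ℝ) 1, |k t| ≤ M) (hg : MemLp g 2 unitVol) :
    ∃ w : ℝ → ℝ, MemLp w 2 unitVol ∧ w =ᵐ[unitVol] fun s => a⁻¹ * (g s - conv k w s) := by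
  have hτ : 0 < (M ^ 2 + 1) / a ^ 2 := by positivity
  -- With this exponent `‖k‖_τ² ≤ M² / (2 τ) < a²`, so the fixed-point map has Lipschitz constant
  -- `‖k‖_τ / a < 1`.
  set τ := (M ^ 2 + 1) / a ^ 2 with hτdef
  set κ := toWL2 τ k hk with hκ
  have hκn : ‖κ‖ < a := by
    refine lt_of_pow_lt_pow_left₀ 2 ha.le ((norm_toWL2_sq_le hτ hk hM).trans_lt ?_)
    rw [div_lt_iff₀ (by positivity), hτdef]
    field_simp
    nlinarith [sq_nonneg M]
  set f : WeightedL2 τ → WeightedL2 τ := fun w => a⁻¹ • (toWL2 τ g hg - convWL2 κ w) with hf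
  have hcontr : ContractingWith (Real.toNNReal (a⁻¹ * ‖κ‖)) f := by
    refine ⟨?_, LipschitzWith.of_dist_le_mul fun v w => ?_⟩
    · rw [← Real.toNNReal_one, Real.toNNReal_lt_toNNReal_iff one_pos, inv_mul_lt_iff₀ ha, mul_one]
      exact hκn
    · rw [dist_eq_norm, dist_eq_norm, Real.coe_toNNReal _ (by positivity), hf]
      simp only
      rw [← smul_sub, sub_sub_sub_cancel_left, ← convCLM_apply, ← convCLM_apply, ← map_sub,
        norm_smul, Real.norm_of_nonneg (by positivity), mul_assoc, norm_sub_rev v w]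
      exact mul_le_mul_of_nonneg_left (norm_convWL2_le _ _) (by positivity)
  have hfix : f hcontr.fixedPoint = hcontr.fixedPoint := hcontr.fixedPoint_isFixedPt
  set w := hcontr.fixedPoint
  refine ⟨w, w.memLp, ?_⟩
  have h1 : f w = toWL2 τ (fun s => a⁻¹ * (g s - conv k w s))
      ((hg.sub (conv_memLp hk w.memLp)).const_smul a⁻¹) := by
    have h2 : convWL2 κ w = toWL2 τ (conv k w) (conv_memLp hk w.memLp) := by
      rw [← convWL2_toWL2 hk w.memLp, toWL2_coeFn]
    rw [hf]
    simp only
    rw [h2, toWL2_sub, smul_toWL2]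
  refine (toWL2_eq_iff (σ := τ) (g := fun s => a⁻¹ * (g s - conv k w s)) w.memLp
    ((hg.sub (conv_memLp hk w.memLp)).const_smul a⁻¹)).1 ?_
  rw [toWL2_coeFn, ← h1, hfix]

/-- Between `r` and `s` the kernel shift contributes `K N` and the added interval of integration
contributes `M N`. -/
theorem lipschitzOnWith_conv {K : NNReal} {k w : ℝ → ℝ} (hk : LipschitzWith K k)
    (hw : MemLp w 2 unitVol) {M N : NNReal} (hM : ∀ t ∈ Icc (0 : ℝ) 1, |k t| ≤ M)
    (hN : ∀ t ∈ Icc (0 : ℝ) 1, |w t| ≤ N) :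
    LipschitzOnWith (K * N + M * N) (conv k w) (Icc 0 1) := by
  have hkm : MemLp k 2 unitVol := memLp_of_continuousOn hk.continuous.continuousOn
  have key : ∀ s ∈ Icc (0 : ℝ) 1, ∀ r ∈ Icc (0 : ℝ) 1, r ≤ s →
      |conv k w s - conv k w r| ≤ (K * N + M * N) * (s - r) := by
    intro s hs r hr hrs
    have hi : ∀ s ∈ Icc (0 : ℝ) 1, IntervalIntegrable (fun t => k (s - t) * w t) volume 0 s :=
      fun s hs => (intervalIntegrable_iff_integrableOn_Ioo_of_le hs.1).2
        (conv_integrable hkm hw hs.2)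
    have hr0s : r ∈ uIcc 0 s := by
      rw [uIcc_of_le hs.1]
      exact ⟨hr.1, hrs⟩
    have h1 := (hi s hs).mono_set (uIcc_subset_uIcc_left hr0s)
    have h2 := (hi s hs).mono_set (uIcc_subset_uIcc_right hr0s)
    have hsplit : conv k w s - conv k w r
        = (∫ t in (0 : ℝ)..r, (k (s - t) * w t - k (r - t) * w t))
          + ∫ t in r..s, k (s - t) * w t := by
      rw [conv, conv, intervalIntegral.integral_sub h1 (hi r hr),
        ← intervalIntegral.integral_add_adjacent_intervals h1 h2]
      ring
    have b1 : |∫ t in (0 : ℝ)..r, (k (s - t) * w t - k (r - t) * w t)|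
        ≤ K * (s - r) * N * |r - 0| := by
      rw [← Real.norm_eq_abs]
      refine intervalIntegral.norm_integral_le_of_norm_le_const fun t ht => ?_
      rw [uIoc_of_le hr.1] at ht
      rw [← sub_mul, norm_mul]
      refine mul_le_mul ?_ (hN t ⟨ht.1.le, ht.2.trans hr.2⟩) (norm_nonneg _) ?_
      · have := hk.dist_le_mul (s - t) (r - t)
        rwa [dist_eq_norm, Real.dist_eq, sub_sub_sub_cancel_right,
          abs_of_nonneg (sub_nonneg.2 hrs)] at this
      · exact mul_nonneg K.2 (sub_nonneg.2 hrs)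
    have b2 : |∫ t in r..s, k (s - t) * w t| ≤ M * N * |s - r| := by
      rw [← Real.norm_eq_abs]
      refine intervalIntegral.norm_integral_le_of_norm_le_const fun t ht => ?_
      rw [uIoc_of_le hrs] at ht
      rw [norm_mul]
      exact mul_le_mul
        (hM _ ⟨sub_nonneg.2 ht.2, by linarith [hs.2, hr.1, ht.1]⟩)
        (hN t ⟨hr.1.trans ht.1.le, ht.2.trans hs.2⟩) (norm_nonneg _) M.2
    rw [hsplit]
    refine (abs_add_le _ _).trans ((add_le_add b1 b2).trans ?_)
    rw [sub_zero, abs_of_nonneg hr.1, abs_of_nonneg (sub_nonneg.2 hrs)]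
    have h3 : K * (s - r) * N * r ≤ K * (s - r) * N * 1 :=
      mul_le_mul_of_nonneg_left hr.2
        (mul_nonneg (mul_nonneg K.2 (sub_nonneg.2 hrs)) N.2)
    linarith
  refine LipschitzOnWith.of_dist_le_mul fun s hs r hr => ?_
  rw [Real.dist_eq, Real.dist_eq, NNReal.coe_add, NNReal.coe_mul, NNReal.coe_mul]
  rcases le_total r s with h | h
  · rw [abs_of_nonneg (sub_nonneg.2 h)]
    exact key s hs r hr h
  · rw [abs_sub_comm, abs_sub_comm s r, abs_of_nonneg (sub_nonneg.2 h)]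
    exact key r hr s hs h

/-- A Volterra convolution equation of the second kind with Lipschitz kernel and right-hand side
has a Lipschitz solution. -/
theorem exists_lipschitz_volterra {a : ℝ} (ha : 0 < a) {K G : NNReal} {k g : ℝ → ℝ}
    (hk : LipschitzWith K k) (hg : LipschitzWith G g) :
    ∃ (C : NNReal) (w : ℝ → ℝ), LipschitzWith C w ∧
      ∀ s ∈ Icc (0 : ℝ) 1, a * w s + conv k w s = g s := by
  have hkm : MemLp k 2 unitVol := memLp_of_continuousOn hk.continuous.continuousOn
  have hgm : MemLp g 2 unitVol := memLp_of_continuousOn hg.continuous.continuousOn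
  have hbound : ∀ {f : ℝ → ℝ}, Continuous f → ∃ M : NNReal, ∀ t ∈ Icc (0 : ℝ) 1, |f t| ≤ M := by
    intro f hf
    obtain ⟨M, hM⟩ := isCompact_Icc.exists_bound_of_continuousOn
      (hf.continuousOn (s := Icc (0 : ℝ) 1))
    exact ⟨M.toNNReal, fun t ht => (hM t ht).trans (Real.le_coe_toNNReal M)⟩
  obtain ⟨M, hM⟩ := hbound hk.continuous
  obtain ⟨Mg, hMg⟩ := hbound hg.continuous
  obtain ⟨v, hv, hveq⟩ := exists_memLp_volterra ha hkm hM hgm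
  set w : ℝ → ℝ := fun s => a⁻¹ * (g s - conv k v s) with hw
  have hwm : MemLp w 2 unitVol := hv.ae_eq hveq
  have hconv : ∀ s ∈ Icc (0 : ℝ) 1, conv k v s = conv k w s := fun s hs =>
    conv_congr Filter.EventuallyEq.rfl hveq hs
  -- Bootstrap: square integrability of `v` bounds the convolution pointwise, so `w` is bounded; a
  -- bounded `w` has Lipschitz convolution with `k`, so `w` is Lipschitz.
  have hN : ∃ N : NNReal, ∀ t ∈ Icc (0 : ℝ) 1, |w t| ≤ N := by
    refine ⟨Real.toNNReal (a⁻¹ * (Mg + ‖toWL2 0 k hkm‖ * ‖toWL2 0 v hv‖)), fun t ht => ?_⟩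
    refine le_trans ?_ (Real.le_coe_toNNReal _)
    rw [hw]
    simp only
    rw [abs_mul, abs_of_pos (inv_pos.2 ha)]
    refine mul_le_mul_of_nonneg_left ((abs_sub _ _).trans (add_le_add (hMg t ht) ?_))
      (inv_pos.2 ha).le
    have h := sq_conv_le 0 hkm hv ht
    simp only [mul_zero, zero_mul, neg_zero, Real.exp_zero, one_mul] at h
    rw [← mul_pow] at h
    exact abs_le_of_sq_le_sq h (by positivity)
  obtain ⟨N, hN⟩ := hN
  have hlip : LipschitzOnWith (‖a⁻¹‖₊ * (G + (K * N + M * N))) w (Icc 0 1) := by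
    have h1 := (hg.lipschitzOnWith (s := Icc (0 : ℝ) 1)).sub (lipschitzOnWith_conv hk hwm hM hN)
    refine LipschitzOnWith.of_dist_le_mul fun s hs r hr => ?_
    have h2 := h1.dist_le_mul s hs r hr
    simp only [hw]
    rw [Real.dist_eq, ← mul_sub, abs_mul, hconv s hs, hconv r hr, NNReal.coe_mul, mul_assoc]
    exact mul_le_mul_of_nonneg_left h2 (abs_nonneg _)
  obtain ⟨w', hw', heq⟩ := hlip.extend_real
  refine ⟨_, w', hw', fun s hs => ?_⟩
  have h3 : w =ᵐ[unitVol] w' := by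
    rw [Filter.EventuallyEq, ae_unitVol_iff]
    exact Filter.Eventually.of_forall fun t ht => heq (Ioo_subset_Icc_self ht)
  rw [← conv_congr Filter.EventuallyEq.rfl h3 hs, ← hconv s hs, ← heq hs, hw]
  simp only
  rw [mul_inv_cancel_left₀ ha.ne', sub_add_cancel]

/-! ### The source element -/

theorem integral_triangle_swap {f : ℝ → ℝ → ℝ} (hf : Continuous (Function.uncurry f)) {s : ℝ}
    (hs : 0 ≤ s) :
    ∫ r in (0 : ℝ)..s, ∫ t in (0 : ℝ)..r, f r t = ∫ t in (0 : ℝ)..s, ∫ r in t..s, f r t := by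
  set D : Set (ℝ × ℝ) := {p | p.2 ≤ p.1} with hD
  have hDm : MeasurableSet D := measurableSet_le measurable_snd measurable_fst
  set F : ℝ → ℝ → ℝ := fun r t => D.indicator (Function.uncurry f) (r, t) with hF
  have hint : IntegrableOn (Function.uncurry F) (uIoc 0 s ×ˢ uIoc 0 s) := by
    have h1 : IntegrableOn (Function.uncurry f) (uIoc 0 s ×ˢ uIoc 0 s) :=
      (hf.continuousOn.integrableOn_compact (isCompact_Icc.prod isCompact_Icc)).mono_set
        (prod_mono uIoc_subset_uIcc uIoc_subset_uIcc)
    exact h1.indicator hDm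
  have h := intervalIntegral_intervalIntegral_swap hint
  have hl : ∫ r in (0 : ℝ)..s, ∫ t in (0 : ℝ)..s, F r t
      = ∫ r in (0 : ℝ)..s, ∫ t in (0 : ℝ)..r, f r t := by
    refine intervalIntegral.integral_congr fun r hr => ?_
    rw [uIcc_of_le hs] at hr
    have h1 : ∀ t, F r t = (Iic r).indicator (f r) t := fun t => rfl
    simp only [h1]
    rw [intervalIntegral.integral_of_le hs, intervalIntegral.integral_of_le hr.1,
      setIntegral_indicator measurableSet_Iic, Ioc_inter_Iic, min_eq_right hr.2]
  have hr : ∫ t in (0 : ℝ)..s, ∫ r in (0 : ℝ)..s, F r t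
      = ∫ t in (0 : ℝ)..s, ∫ r in t..s, f r t := by
    refine intervalIntegral.integral_congr_ae (Filter.Eventually.of_forall fun t ht => ?_)
    rw [uIoc_of_le hs] at ht
    have h1 : ∀ r, F r t = (Ici t).indicator (fun r => f r t) r := fun r => rfl
    simp only [h1]
    have h2 : Ioc 0 s ∩ Ici t = Icc t s := by
      ext r
      exact ⟨fun h => ⟨h.2, h.1.2⟩, fun h => ⟨⟨ht.1.trans_le h.1, h.2⟩, h.1⟩⟩
    rw [intervalIntegral.integral_of_le hs, intervalIntegral.integral_of_le ht.2,
      setIntegral_indicator measurableSet_Ici, h2, integral_Icc_eq_integral_Ioc]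
  rw [← hl, h, hr]

/-- The equation `F'(x₀) ω = x₀ - x₀(0)` has a solution in `H₁(0,1)`. -/
theorem SolutionSmoothness.exists_source {x₀ : ℝ → ℝ} (h : SolutionSmoothness x₀) :
    ∃ w : ℝ → ℝ, MemH1 w ∧ ∀ s ∈ Icc (0 : ℝ) 1, 2 * conv x₀ w s = x₀ s - x₀ 0 := by
  obtain ⟨K, k, hk, hx⟩ := h.exists_lipschitz_deriv
  -- This is the differentiated source equation, with `k` in the role of `x₀'`; it is of the second
  -- kind because `x₀ 0 > 0`.
  obtain ⟨C, w, hw, hweq⟩ := exists_lipschitz_volterra (g := fun t => 1 / 2 * k t)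
    (G := ‖(1 / 2 : ℝ)‖₊ * K) h.pos_zero hk
    (LipschitzWith.of_dist_le_mul fun s r => by
      rw [Real.dist_eq, ← mul_sub, abs_mul, NNReal.coe_mul, mul_assoc]
      exact mul_le_mul_of_nonneg_left (hk.dist_le_mul s r) (abs_nonneg _))
  refine ⟨w, memH1_of_lipschitzOnWith hw.lipschitzOnWith, fun s hs => ?_⟩
  have hkc := hk.continuous
  have hwc := hw.continuous
  have hprim : Continuous fun t => ∫ r in (0 : ℝ)..t, k r :=
    intervalIntegral.continuous_primitive (fun a b => hkc.intervalIntegrable a b) 0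
  -- Insert `x₀ (s - t) = x₀ 0 + ∫ r in t..s, k (r - t)`; exchanging the integrals then integrates
  -- the differentiated equation back.
  have h1 : conv x₀ w s = x₀ 0 * (∫ t in (0 : ℝ)..s, w t)
      + ∫ t in (0 : ℝ)..s, ∫ r in t..s, k (r - t) * w t := by
    rw [conv, ← intervalIntegral.integral_const_mul, ← intervalIntegral.integral_add]
    · refine intervalIntegral.integral_congr fun t ht => ?_
      rw [uIcc_of_le hs.1] at ht
      rw [hx (s - t) ⟨sub_nonneg.2 ht.2, by linarith [hs.2, ht.1]⟩, add_mul,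
        intervalIntegral.integral_mul_const, intervalIntegral.integral_comp_sub_right k t, sub_self]
    · exact (continuous_const.mul hwc).intervalIntegrable _ _
    · have h2 : ∀ t, ∫ r in t..s, k (r - t) * w t = (∫ r in (0 : ℝ)..(s - t), k r) * w t :=
        fun t => by
          rw [intervalIntegral.integral_mul_const, intervalIntegral.integral_comp_sub_right k t,
            sub_self]
      simp only [h2]
      exact ((hprim.comp (continuous_const.sub continuous_id)).mul hwc).intervalIntegrable _ _
  have h3 : ∫ t in (0 : ℝ)..s, ∫ r in t..s, k (r - t) * w t = ∫ r in (0 : ℝ)..s, conv k w r := by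
    refine (integral_triangle_swap (f := fun r t => k (r - t) * w t) ?_ hs.1).symm
    exact (hkc.comp (continuous_fst.sub continuous_snd)).mul (hwc.comp continuous_snd)
  have h4 : ∫ r in (0 : ℝ)..s, conv k w r = ∫ r in (0 : ℝ)..s, (1 / 2 * k r - x₀ 0 * w r) := by
    refine intervalIntegral.integral_congr fun r hr => ?_
    rw [uIcc_of_le hs.1] at hr
    have := hweq r ⟨hr.1, hr.2.trans hs.2⟩
    linarith
  rw [h1, h3, h4, intervalIntegral.integral_sub (f := fun r => 1 / 2 * k r)
    (g := fun r => x₀ 0 * w r) ((continuous_const.mul hkc).intervalIntegrable _ _)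
    ((continuous_const.mul hwc).intervalIntegrable _ _), intervalIntegral.integral_const_mul,
    intervalIntegral.integral_const_mul, hx s hs]
  ring

/-! ### Recovering the initial value from noisy data -/

theorem SolutionSmoothness.exists_lipschitzOnWith {x₀ : ℝ → ℝ} (h : SolutionSmoothness x₀) :
    ∃ M : NNReal, LipschitzOnWith M x₀ (Icc 0 1) := by
  obtain ⟨K, k, hk, hx⟩ := h.exists_lipschitz_deriv
  obtain ⟨M, hM⟩ := isCompact_Icc.exists_bound_of_continuousOn
    (hk.continuous.continuousOn (s := Icc (0 : ℝ) 1))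
  have h1 := lipschitzOnWith_primitive (M := M.toNNReal)
    (hk.continuous.integrableOn_Icc.mono_set Ioo_subset_Icc_self)
    (Filter.Eventually.of_forall fun t ht =>
      (hM t (Ioo_subset_Icc_self ht)).trans (Real.le_coe_toNNReal M)) (x₀ 0)
  refine ⟨M.toNNReal, fun s hs t ht => ?_⟩
  rw [hx s hs, hx t ht]
  exact h1 hs ht

theorem norm_toWL2_sq_le_integral {σ : ℝ} (hσ : 0 ≤ σ) {f : ℝ → ℝ} (hf : MemLp f 2 unitVol) :
    ‖toWL2 σ f hf‖ ^ 2 ≤ ∫ t in Ioo (0 : ℝ) 1, f t ^ 2 := by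
  rw [norm_toWL2_sq]
  refine integral_mono_of_nonneg (Filter.Eventually.of_forall fun t => by positivity)
    hf.integrable_sq ?_
  filter_upwards [ae_restrict_mem measurableSet_Ioo] with t ht
  refine mul_le_of_le_one_left (sq_nonneg _) (Real.exp_le_one_iff.2 ?_)
  have := ht.1
  rw [neg_nonpos]
  positivity

theorem norm_constWL2_le {σ : ℝ} (hσ : 0 ≤ σ) (a : ℝ) : ‖constWL2 σ a‖ ≤ |a| := by
  refine le_of_sq_le_sq ?_ (abs_nonneg a)
  refine (norm_toWL2_sq_le_integral hσ _).trans (le_of_eq ?_)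
  simp

theorem UnitL2.norm_sq_eq_integral (ξ : UnitL2) :
    ‖ξ‖ ^ 2 = ∫ t in Ioo (0 : ℝ) 1, ξ t ^ 2 := by
  rw [← real_inner_self_eq_norm_sq, L2.inner_def]
  refine integral_congr_ae (Filter.Eventually.of_forall fun t => ?_)
  simp only [Real.inner_apply, sq]

theorem norm_toWL2_unitL2_le {σ : ℝ} (hσ : 0 ≤ σ) (ξ : UnitL2) :
    ‖toWL2 σ ξ (Lp.memLp ξ)‖ ≤ ‖ξ‖ := by
  refine le_of_sq_le_sq ?_ (norm_nonneg ξ)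
  rw [UnitL2.norm_sq_eq_integral]
  exact norm_toWL2_sq_le_integral hσ _

theorem noisyData_eq {σ : ℝ} {x₀ : ℝ → ℝ} (hx₀ : SolutionSmoothness x₀) (ξ : UnitL2) :
    noisyData (hx₀.elt σ) ξ =ᵐ[unitVol] fun t => conv x₀ x₀ t + ξ t := by
  have h0 := memLp_of_continuousOn hx₀.continuousOn
  have h : noisyData (hx₀.elt σ) ξ = toWL2 σ (fun t => conv x₀ x₀ t + ξ t)
      ((conv_memLp h0 h0).add (Lp.memLp ξ)) := by
    rw [noisyData, F, SolutionSmoothness.elt, convWL2_toWL2, toWL2_add]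
  rw [h]
  exact coeFn_toWL2 σ _

/-- Cauchy-Schwarz against the constant `1` on `(0,h)`. After division by `h²` the noise contributes
`δ h^{-3/2}`. -/
theorem abs_integral_le_sqrt_mul_norm (ξ : UnitL2) {h : ℝ} (h0 : 0 ≤ h) (h1 : h ≤ 1) :
    |∫ t in (0 : ℝ)..h, ξ t| ≤ √h * ‖ξ‖ := by
  refine abs_le_of_sq_le_sq ?_ (by positivity)
  rw [mul_pow, Real.sq_sqrt h0, UnitL2.norm_sq_eq_integral, intervalIntegral.integral_of_le h0,
    integral_Ioc_eq_integral_Ioo]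
  have hξ := memLp_of_mem_Icc (Lp.memLp ξ) h1
  have hc := sq_integral_mul_le (memLp_const (1 : ℝ) (μ := volume.restrict (Ioo 0 h))) hξ
  simp only [one_mul, one_pow, integral_const, smul_eq_mul, mul_one, measureReal_restrict_apply_univ,
    Real.volume_real_Ioo_of_le h0, sub_zero] at hc
  refine hc.trans (mul_le_mul_of_nonneg_left ?_ h0)
  exact setIntegral_mono_set (Lp.memLp ξ).integrable_sq
    (Filter.Eventually.of_forall fun t => sq_nonneg _) (Ioo_subset_Ioo_right h1).eventuallyLE

/-- By Lipschitz continuity both factors in the integrand are within `O(s)` of `x₀ 0`, and the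
interval has length `s`. -/
theorem SolutionSmoothness.abs_conv_self_sub_le {x₀ : ℝ → ℝ} (hx₀ : SolutionSmoothness x₀) :
    ∃ D : ℝ, 0 ≤ D ∧ ∀ s ∈ Icc (0 : ℝ) 1, |conv x₀ x₀ s - x₀ 0 ^ 2 * s| ≤ D * s ^ 2 := by
  obtain ⟨M, hM⟩ := hx₀.exists_lipschitzOnWith
  have hlip : ∀ t ∈ Icc (0 : ℝ) 1, |x₀ t - x₀ 0| ≤ M * t := fun t ht => by
    have := hM.dist_le_mul t ht 0 (by simp)
    rwa [Real.dist_eq, Real.dist_eq, sub_zero, abs_of_nonneg ht.1] at this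
  have ha := hx₀.pos_zero
  have hM0 : 0 ≤ (M : ℝ) := M.2
  refine ⟨2 * x₀ 0 * M + M ^ 2, by positivity, fun s hs => ?_⟩
  have hm := memLp_of_continuousOn hx₀.continuousOn
  have hi : IntervalIntegrable (fun t => x₀ (s - t) * x₀ t) volume 0 s :=
    (intervalIntegrable_iff_integrableOn_Ioo_of_le hs.1).2 (conv_integrable hm hm hs.2)
  have hc : x₀ 0 ^ 2 * s = ∫ _ in (0 : ℝ)..s, x₀ 0 ^ 2 := by
    rw [intervalIntegral.integral_const, sub_zero, smul_eq_mul, mul_comm]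
  rw [conv, hc, ← intervalIntegral.integral_sub hi (by simp), ← Real.norm_eq_abs]
  have hb := intervalIntegral.norm_integral_le_of_norm_le_const (a := 0) (b := s)
    (f := fun t => x₀ (s - t) * x₀ t - x₀ 0 ^ 2) (C := (2 * x₀ 0 * M + M ^ 2) * s) fun t ht => by
      rw [uIoc_of_le hs.1] at ht
      have h1 := hlip (s - t) ⟨sub_nonneg.2 ht.2, by linarith [hs.2, ht.1]⟩
      have h2 := hlip t ⟨ht.1.le, ht.2.trans hs.2⟩
      have h3 : x₀ (s - t) * x₀ t - x₀ 0 ^ 2 = x₀ 0 * (x₀ (s - t) - x₀ 0) + x₀ 0 * (x₀ t - x₀ 0)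
          + (x₀ (s - t) - x₀ 0) * (x₀ t - x₀ 0) := by ring
      have hst : M * (s - t) ≤ M * s := mul_le_mul_of_nonneg_left (by linarith [ht.1]) hM0
      have ht' : M * t ≤ M * 1 := mul_le_mul_of_nonneg_left (ht.2.trans hs.2) hM0
      have hts : M * t ≤ M * s := mul_le_mul_of_nonneg_left ht.2 hM0
      rw [h3, Real.norm_eq_abs]
      refine (abs_add_le _ _).trans ((add_le_add (abs_add_le _ _) le_rfl).trans ?_)
      rw [abs_mul, abs_mul, abs_mul, abs_of_pos ha]
      have e1 := mul_le_mul_of_nonneg_left (h1.trans hst) ha.le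
      have e2 := mul_le_mul_of_nonneg_left (h2.trans hts) ha.le
      have e3 := mul_le_mul (h1.trans hst) (h2.trans ht') (abs_nonneg _)
        (mul_nonneg hM0 hs.1)
      linarith
  rw [sub_zero, abs_of_nonneg hs.1] at hb
  exact hb.trans (le_of_eq (by ring))

/-- Factor `N - a² = (√N - a)(√N + a)` and use `√N + a ≥ a`. For `N ≤ 0` the root is `0` and `|N -
a²| ≥ a²`. -/
theorem abs_sqrt_sub_le {a N : ℝ} (ha : 0 < a) : |√N - a| ≤ |N - a ^ 2| / a := by
  rw [le_div_iff₀ ha]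
  rcases le_total 0 N with hN | hN
  · have h1 : N - a ^ 2 = (√N - a) * (√N + a) := by
      nth_rw 1 [← Real.sq_sqrt hN]
      ring
    rw [h1, abs_mul, abs_of_nonneg (add_nonneg (Real.sqrt_nonneg N) ha.le)]
    exact mul_le_mul_of_nonneg_left (le_add_of_nonneg_left (Real.sqrt_nonneg N)) (abs_nonneg _)
  · rw [Real.sqrt_eq_zero_of_nonpos hN, zero_sub, abs_neg, abs_of_pos ha,
      abs_of_nonpos (by nlinarith)]
    nlinarith

/-- Accuracy of the value reconstructed from local averages of the noisy data. -/
theorem SolutionSmoothness.abs_reference_sub_le {x₀ : ℝ → ℝ} (hx₀ : SolutionSmoothness x₀) :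
    ∃ D : ℝ, 0 ≤ D ∧ ∀ (σ : ℝ) (ξ : UnitL2) (h : ℝ), 0 < h → h ≤ 1 →
      |√(2 / h ^ 2 * ∫ t in (0 : ℝ)..h, noisyData (hx₀.elt σ) ξ t) - x₀ 0|
        ≤ D * (h + √h * ‖ξ‖ / h ^ 2) := by
  obtain ⟨D, hD0, hD⟩ := hx₀.abs_conv_self_sub_le
  have ha := hx₀.pos_zero
  refine ⟨(2 * D + 2) / x₀ 0, by positivity, fun σ ξ h h0 h1 => ?_⟩
  have hm := memLp_of_continuousOn hx₀.continuousOn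
  have hii : ∀ {f : ℝ → ℝ}, MemLp f 2 unitVol → IntervalIntegrable f volume 0 h := fun hf =>
    (intervalIntegrable_iff_integrableOn_Ioo_of_le h0.le).2
      ((memLp_of_mem_Icc hf h1).integrable (by norm_num))
  have hsplit : ∫ t in (0 : ℝ)..h, noisyData (hx₀.elt σ) ξ t
      = (∫ t in (0 : ℝ)..h, conv x₀ x₀ t) + ∫ t in (0 : ℝ)..h, ξ t := by
    rw [← intervalIntegral.integral_add (hii (conv_memLp hm hm)) (hii (Lp.memLp ξ))]
    refine intervalIntegral.integral_congr_ae ?_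
    filter_upwards [ae_mem_Ioo_of_mem_Ioc (ae_unitVol_iff.1 (noisyData_eq (σ := σ) hx₀ ξ))]
      with t ht h't
    rw [uIoc_of_le h0.le] at h't
    exact ht ⟨h't.1, h't.2.trans h1⟩
  have hξ := abs_integral_le_sqrt_mul_norm ξ h0.le h1
  have hlin : ∫ t in (0 : ℝ)..h, x₀ 0 ^ 2 * t = x₀ 0 ^ 2 * (h ^ 2 / 2) := by
    rw [intervalIntegral.integral_const_mul, integral_id]
    ring
  have hconv : |(∫ t in (0 : ℝ)..h, conv x₀ x₀ t) - x₀ 0 ^ 2 * (h ^ 2 / 2)| ≤ D * h ^ 3 := by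
    rw [← hlin, ← intervalIntegral.integral_sub (hii (conv_memLp hm hm))
      (Continuous.intervalIntegrable (by fun_prop) _ _), ← Real.norm_eq_abs]
    have hb := intervalIntegral.norm_integral_le_of_norm_le_const (a := 0) (b := h)
      (f := fun t => conv x₀ x₀ t - x₀ 0 ^ 2 * t) (C := D * h ^ 2) fun t ht => by
        rw [uIoc_of_le h0.le] at ht
        refine (hD t ⟨ht.1.le, ht.2.trans h1⟩).trans (mul_le_mul_of_nonneg_left ?_ hD0)
        exact pow_le_pow_left₀ ht.1.le ht.2 2
    rw [sub_zero, abs_of_pos h0] at hb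
    exact hb.trans (le_of_eq (by ring))
  have hN : |2 / h ^ 2 * (∫ t in (0 : ℝ)..h, noisyData (hx₀.elt σ) ξ t) - x₀ 0 ^ 2|
      ≤ 2 * D * h + 2 * (√h * ‖ξ‖ / h ^ 2) := by
    have e1 : 2 / h ^ 2 * (∫ t in (0 : ℝ)..h, noisyData (hx₀.elt σ) ξ t) - x₀ 0 ^ 2
        = 2 / h ^ 2 * (((∫ t in (0 : ℝ)..h, conv x₀ x₀ t) - x₀ 0 ^ 2 * (h ^ 2 / 2))
          + ∫ t in (0 : ℝ)..h, ξ t) := by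
      rw [hsplit]
      field_simp
      ring
    rw [e1, abs_mul, abs_of_pos (by positivity)]
    refine (mul_le_mul_of_nonneg_left ((abs_add_le _ _).trans (add_le_add hconv hξ))
      (by positivity)).trans (le_of_eq ?_)
    field_simp
  refine (abs_sqrt_sub_le ha).trans ?_
  rw [div_mul_eq_mul_div (2 * D + 2)]
  refine div_le_div_of_nonneg_right (hN.trans ?_) ha.le
  have e2 : 0 ≤ D * (√h * ‖ξ‖ / h ^ 2) := by positivity
  nlinarith

/-! ### Projection errors, norm comparison and the choice of constants -/

theorem norm_sub_starProjection_le {σ L : ℝ} {X : ℕ → Submodule ℝ (WeightedL2 σ)}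
    [∀ m, FiniteDimensional ℝ (X m)] (hX : ApproximationPower σ L X) {m : ℕ} (hm : 1 ≤ m)
    {x : ℝ → ℝ} (hx : MemH1 x) :
    ‖toWL2 σ x hx.memLp - (X m).starProjection (toWL2 σ x hx.memLp)‖ ≤ L / m * h1Norm σ hx := by
  refine le_trans (le_of_eq ?_) (hX.infDist_le m hm x hx)
  rw [Submodule.starProjection_minimal, Metric.infDist_eq_iInf]
  simp only [dist_eq_norm]
  rfl

/-- The measures compare with factor `e^{2σ}`, and the exponent `2` of the norm takes its square
root. -/
theorem eLpNorm_unitVol_le {σ : ℝ} (hσ : 0 ≤ σ) {f : ℝ → ℝ} (hf : MemLp f 2 unitVol) :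
    eLpNorm f 2 unitVol ≤ ENNReal.ofReal (Real.exp σ * ‖toWL2 σ f hf‖) := by
  refine (eLpNorm_mono_measure f (unitVol_le σ)).trans ?_
  rw [eLpNorm_smul_measure_of_ne_top (by norm_num), ENNReal.ofReal_mul (Real.exp_pos _).le, toWL2,
    Lp.norm_toLp, ENNReal.ofReal_toReal ((memLp_weightedVol_iff σ f).2 hf).2.ne, smul_eq_mul,
    abs_of_nonneg hσ]
  refine mul_le_mul_left (le_of_eq ?_) _
  rw [ENNReal.ofReal_rpow_of_pos (Real.exp_pos _), ← Real.exp_mul]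
  congr 2
  norm_num
  ring

/-- Keeps the base of the negative power in the averaging length positive. -/
theorem c1Norm_pos {x₀ : ℝ → ℝ} (hx₀ : SolutionSmoothness x₀) : 0 < c1Norm x₀ := by
  refine lt_max_of_lt_left (ENNReal.toReal_pos ?_ hx₀.memW2Inf.1.2.ne)
  rw [Ne, eLpNorm_eq_zero_iff hx₀.memW2Inf.1.1 (by simp), Filter.EventuallyEq, ae_unitVol_iff]
  intro h
  have h1 : ∀ᵐ t : ℝ, t ∉ Ioo (0 : ℝ) 1 := by
    filter_upwards [h] with t ht h't
    exact (hx₀.pos t h't).ne' (ht h't)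
  have h2 : {t : ℝ | ¬t ∉ Ioo (0 : ℝ) 1} = Ioo 0 1 := by
    ext t
    exact not_not
  rw [ae_iff, h2, Real.volume_Ioo] at h1
  norm_num at h1

/-- The parameter choice `α = c e²`, `δ = e⁵` meets the smallness condition of
`exists_projected_lavrentiev_solution`. -/
theorem lavrentiev_smallness {k n R p q w δ e c C P P' g : ℝ} (he0 : 0 < e) (he1 : e ≤ 1)
    (he5 : δ = e ^ 5) (hc1 : 1 ≤ c) (hR0 : 0 ≤ R) (hP0 : 0 ≤ P) (hP'0 : 0 ≤ P')
    (hg0 : 0 < g) (hg1 : g ≤ 1 / 4) (hw : w = 1 / 4 - g)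
    (hEc : C + (1 + 2 * R * P) + 2 * R * P' + P ≤ g / 2 * c) (hk : k ≤ C * e ^ 2) (hn : n ≤ δ)
    (hp : p ≤ P * δ) (hq : q ≤ P' * δ) :
    (c * e ^ 2 * k + n + 2 * R * p + c * e ^ 2 * (2 * R * q)
        + ((1 / 2 - g) * (c * e ^ 2)) ^ 2) / (c * e ^ 2) + c * e ^ 2 * w + p
      ≤ (1 / 2 - g) * (c * e ^ 2) := by
  have hc0 : 0 < c := one_pos.trans_le hc1
  -- After division by `α = c e²` a term of order `e⁴` still leaves the required `e²`, so the full
  -- strength of `δ = e⁵` is not needed.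
  have hδe : δ ≤ e ^ 4 := by
    rw [he5]
    exact pow_le_pow_of_le_one he0.le he1 (by norm_num)
  have hδe2 : δ ≤ e ^ 2 := by
    rw [he5]
    exact pow_le_pow_of_le_one he0.le he1 (by norm_num)
  have hp4 : p ≤ P * e ^ 4 := hp.trans (mul_le_mul_of_nonneg_left hδe hP0)
  have hp2 : p ≤ P * e ^ 2 := hp.trans (mul_le_mul_of_nonneg_left hδe2 hP0)
  have hq2 : q ≤ P' * e ^ 2 := hq.trans (mul_le_mul_of_nonneg_left hδe2 hP'0)
  have hn4 : n ≤ e ^ 4 := hn.trans hδe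
  rw [hw]
  calc _ ≤ (c * e ^ 2 * (C * e ^ 2) + e ^ 4 + 2 * R * (P * e ^ 4)
        + c * e ^ 2 * (2 * R * (P' * e ^ 2)) + ((1 / 2 - g) * (c * e ^ 2)) ^ 2) / (c * e ^ 2)
        + c * e ^ 2 * (1 / 4 - g) + P * e ^ 2 := by
          gcongr
    _ = e ^ 2 * (C + (1 + 2 * R * P) / c + 2 * R * P' + (1 / 2 - g) ^ 2 * c
        + c * (1 / 4 - g) + P) := by
          field_simp
          ring
    _ ≤ e ^ 2 * ((1 / 2 - g) * c) := by
          refine mul_le_mul_of_nonneg_left ?_ (by positivity)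
          have b1 : (1 + 2 * R * P) / c ≤ 1 + 2 * R * P :=
            div_le_self (by positivity) hc1
          have b2 : g ^ 2 * c ≤ g / 4 * c := by
            refine mul_le_mul_of_nonneg_right ?_ hc0.le
            nlinarith
          have b3 : 0 ≤ g * c := by positivity
          -- For `s = 1/2 - g` and `‖ω‖ = 1/4 - g` one has `s - s² - ‖ω‖ = g - g² ≥ 3g/4`; this
          -- surplus, times `c`, pays for the remaining constants, which total at most `g c / 2`.
          have b4 : (1 / 2 - g) ^ 2 * c + c * (1 / 4 - g)
              = (1 / 2 - g) * c - g * c + g ^ 2 * c := by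
            ring
          linarith
    _ = _ := by ring

end

end Autoconv

/-! ### Assembling the convergence rate -/

theorem mainTheorem3 (x₀ : ℝ → ℝ) (hx₀ : Autoconv.SolutionSmoothness x₀) (σ : ℝ) (hσ : 0 < σ)
    (haccretive : ∀ v : Autoconv.WeightedL2 σ, 0 ≤ ⟪Autoconv.F' (hx₀.elt σ) v, v⟫_ℝ)
    (hω : ∀ ω : Autoconv.WeightedL2 σ,
      Autoconv.F' (hx₀.elt σ) ω = hx₀.elt σ - Autoconv.constWL2 σ (x₀ 0) → ‖ω‖ < 1 / 4)
    (L : ℝ) :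
    ∃ c : ℝ, 0 < c ∧ ∃ δ₀ : ℝ, 0 < δ₀ ∧ δ₀ ≤ 1 ∧
      ∀ (X : ℕ → Submodule ℝ (Autoconv.WeightedL2 σ)) [∀ m, FiniteDimensional ℝ (X m)],
        Autoconv.ApproximationPower σ L X →
      ∀ δ : ℝ, 0 < δ → δ ≤ δ₀ → ∀ m : ℕ, σ / δ ≤ m →
      ∀ ξ : Autoconv.UnitL2, ‖ξ‖ ≤ δ →
        ∃ x : Autoconv.WeightedL2 σ,
          Autoconv.IsDiscreteLavrentievSolution (X m) (c * δ ^ (2 / 5 : ℝ))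
            (Autoconv.referenceElement (Autoconv.averagingLength x₀ δ)
              (Autoconv.noisyData (hx₀.elt σ) ξ))
            (Autoconv.noisyData (hx₀.elt σ) ξ) x ∧
          ‖hx₀.elt σ - x‖ ≤ c * δ ^ (2 / 5 : ℝ) ∧
          MeasureTheory.eLpNorm (fun t => x₀ t - x t) 2 Autoconv.unitVol
            ≤ ENNReal.ofReal (Real.exp σ * c * δ ^ (2 / 5 : ℝ)) := by
  obtain ⟨M, hM⟩ := hx₀.exists_lipschitzOnWith
  have hx₀1 := Autoconv.memH1_of_lipschitzOnWith hM
  obtain ⟨w, hw1, hw⟩ := hx₀.exists_source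
  obtain ⟨D, hD0, hD⟩ := hx₀.abs_reference_sub_le
  have hm₀ := Autoconv.memLp_of_continuousOn hx₀.continuousOn
  set ω := Autoconv.toWL2 σ w hw1.memLp with hωdef
  have hωeq : Autoconv.F' (hx₀.elt σ) ω = hx₀.elt σ - Autoconv.constWL2 σ (x₀ 0) := by
    rw [Autoconv.F', Autoconv.SolutionSmoothness.elt, Autoconv.constWL2, hωdef,
      Autoconv.convWL2_toWL2, Autoconv.smul_toWL2, Autoconv.toWL2_sub, Autoconv.toWL2_eq_iff,
      Filter.EventuallyEq, Autoconv.ae_unitVol_iff]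
    exact Filter.Eventually.of_forall fun s hs => hw s (Ioo_subset_Icc_self hs)
  have hωn := hω ω hωeq
  set κ₀ : ℝ := 2 / 3 * Autoconv.c1Norm x₀ ^ 2 with hκ₀
  have hκ₀pos : 0 < κ₀ := by
    have := Autoconv.c1Norm_pos hx₀
    positivity
  set κ : ℝ := κ₀ ^ (-(2 / 5) : ℝ) with hκ
  have hκpos : 0 < κ := Real.rpow_pos_of_pos hκ₀pos _
  set R := ‖hx₀.elt σ‖ with hR
  set P := |L| * Autoconv.h1Norm σ hx₀1 / σ with hP
  set P' := |L| * Autoconv.h1Norm σ hw1 / σ with hP'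
  have hnn : ∀ {x : ℝ → ℝ} (hx : Autoconv.MemH1 x), 0 ≤ Autoconv.h1Norm σ hx := fun hx =>
    mul_nonneg (by norm_num) (Real.sqrt_nonneg _)
  have hP0 : 0 ≤ P := div_nonneg (mul_nonneg (abs_nonneg L) (hnn hx₀1)) hσ.le
  have hP'0 : 0 ≤ P' := div_nonneg (mul_nonneg (abs_nonneg L) (hnn hw1)) hσ.le
  have hR0 : 0 ≤ R := norm_nonneg _
  set C := D * (κ + √κ / κ ^ 2) with hC
  have hC0 : 0 ≤ C := by positivity
  set E := C + (1 + 2 * R * P) + 2 * R * P' + P with hE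
  have hE0 : 0 ≤ E := by positivity
  -- The gap in the smallness condition on the source element; it is positive because the `ω`
  -- constructed above solves the source equation.
  set g := 1 / 4 - ‖ω‖ with hg
  have hg0 : 0 < g := sub_pos.2 hωn
  have hg1 : g ≤ 1 / 4 := sub_le_self _ (norm_nonneg ω)
  -- Large enough that `g c / 2` exceeds `E`, the sum of the constants in the error terms.
  set c := 1 + 2 * E / g with hc
  have hc1 : 1 ≤ c := le_add_of_nonneg_right (by positivity)
  have hc0 : 0 < c := one_pos.trans_le hc1
  have hEc : E ≤ g / 2 * c := by
    rw [hc]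
    have : g / 2 * (1 + 2 * E / g) = g / 2 + E := by field_simp
    linarith
  -- The bound `1` gives `e ≤ 1`; the bound `κ₀` gives `h = (δ / κ₀)^{2/5} ≤ 1`, so the average
  -- stays inside the unit interval.
  refine ⟨c, hc0, min 1 κ₀, lt_min one_pos hκ₀pos, min_le_left _ _, ?_⟩
  intro X _ hX δ hδ0 hδ m hm ξ hξ
  have hm1 : 1 ≤ m := by
    have : (0 : ℝ) < m := (div_pos hσ hδ0).trans_le hm
    exact_mod_cast this
  have hmpos : (0 : ℝ) < m := by exact_mod_cast hm1
  have hproj : ∀ {x : ℝ → ℝ} (hx : Autoconv.MemH1 x),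
      ‖Autoconv.toWL2 σ x hx.memLp - (X m).starProjection (Autoconv.toWL2 σ x hx.memLp)‖
        ≤ |L| * Autoconv.h1Norm σ hx / σ * δ := fun {x} hx => by
    refine (Autoconv.norm_sub_starProjection_le hX hm1 hx).trans ?_
    have h1 : 1 / (m : ℝ) ≤ δ / σ := by
      rw [div_le_div_iff₀ hmpos hσ, one_mul]
      rw [div_le_iff₀ hδ0] at hm
      linarith
    calc L / m * Autoconv.h1Norm σ hx ≤ |L| / m * Autoconv.h1Norm σ hx :=
          mul_le_mul_of_nonneg_right (div_le_div_of_nonneg_right (le_abs_self L) hmpos.le) (hnn hx)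
      _ = |L| * Autoconv.h1Norm σ hx * (1 / m) := by ring
      _ ≤ |L| * Autoconv.h1Norm σ hx * (δ / σ) :=
          mul_le_mul_of_nonneg_left h1 (mul_nonneg (abs_nonneg L) (hnn hx))
      _ = _ := by ring
  set e := δ ^ (1 / 5 : ℝ) with he
  have he0 : 0 < e := Real.rpow_pos_of_pos hδ0 _
  have he1 : e ≤ 1 := Real.rpow_le_one hδ0.le (hδ.trans (min_le_left _ _)) (by norm_num)
  have he5 : δ = e ^ 5 := by
    rw [he, ← Real.rpow_natCast, ← Real.rpow_mul hδ0.le]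
    norm_num
  have he2 : δ ^ (2 / 5 : ℝ) = e ^ 2 := by
    rw [he, ← Real.rpow_natCast, ← Real.rpow_mul hδ0.le]
    norm_num
  set h := Autoconv.averagingLength x₀ δ with hh
  have hhe : h = κ * e ^ 2 := by rw [hh, Autoconv.averagingLength, he2]
  have hh0 : 0 < h := by rw [hhe]; positivity
  have hh1 : h ≤ 1 := by
    rw [hh, Autoconv.averagingLength, ← hκ₀, Real.rpow_neg hκ₀pos.le, inv_mul_le_iff₀
      (Real.rpow_pos_of_pos hκ₀pos _), mul_one]
    exact Real.rpow_le_rpow hδ0.le (hδ.trans (min_le_right _ _)) (by norm_num)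
  set y := Autoconv.noisyData (hx₀.elt σ) ξ with hy
  -- With `h = κ e²` and `δ = e⁵`, both `h` and `√h δ / h²` are exact multiples of `e²`: this is the
  -- balance behind the exponent `2/5`.
  have hv : |√(2 / h ^ 2 * ∫ t in (0 : ℝ)..h, y t) - x₀ 0| ≤ C * e ^ 2 := by
    refine (hD σ ξ h hh0 hh1).trans ?_
    rw [hC, mul_assoc]
    refine mul_le_mul_of_nonneg_left ?_ hD0
    have hsq : √h = √κ * e := by
      rw [hhe, Real.sqrt_mul hκpos.le, Real.sqrt_sq he0.le]
    have h1 : √h * ‖ξ‖ / h ^ 2 ≤ √h * δ / h ^ 2 := by gcongr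
    refine (add_le_add le_rfl h1).trans (le_of_eq ?_)
    rw [hsq, hhe, he5]
    field_simp
  set v := √(2 / h ^ 2 * ∫ t in (0 : ℝ)..h, y t) with hvdef
  have href : Autoconv.referenceElement h y - hx₀.elt σ
      = Autoconv.constWL2 σ (v - x₀ 0) - (2 : ℝ) • Autoconv.convCLM σ (hx₀.elt σ) ω := by
    have h1 : Autoconv.constWL2 σ (v - x₀ 0)
        = Autoconv.constWL2 σ v - Autoconv.constWL2 σ (x₀ 0) := rfl
    have h2 : (2 : ℝ) • Autoconv.convCLM σ (hx₀.elt σ) ω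
        = hx₀.elt σ - Autoconv.constWL2 σ (x₀ 0) := hωeq
    rw [h1, h2, Autoconv.referenceElement, ← hvdef]
    abel
  have hα : 0 < c * e ^ 2 := by positivity
  -- Here `s = 1/2 - g = 1/4 + ‖ω‖`, strictly below `1/2` as the contraction requires; the error `s
  -- α` is then below `α = c δ^{2/5}`.
  obtain ⟨x, hxX, hxeq, hxn⟩ := Autoconv.exists_projected_lavrentiev_solution
    (Autoconv.convCLM σ) Autoconv.norm_convWL2_le Autoconv.convWL2_comm (hx₀.elt σ) haccretive (X m)
    hα (ξ := Autoconv.toWL2 σ ξ (Lp.memLp ξ)) href (s := 1 / 2 - g) (by linarith) (by linarith) (by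
      have a1 := (Autoconv.norm_constWL2_le hσ.le (v - x₀ 0)).trans hv
      have a2 := (Autoconv.norm_toWL2_unitL2_le hσ.le ξ).trans hξ
      have a3 : ‖hx₀.elt σ - (X m).starProjection (hx₀.elt σ)‖ ≤ P * δ := hproj hx₀1
      have a4 : ‖ω - (X m).starProjection ω‖ ≤ P' * δ := hproj hw1
      exact Autoconv.lavrentiev_smallness he0 he1 he5 hc1 hR0 hP0 hP'0 hg0 hg1
        (by rw [hg]; ring) hEc a1 a2 a3 a4)
  have hsα : (1 / 2 - g) * (c * e ^ 2) ≤ c * e ^ 2 := by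
    refine mul_le_of_le_one_left hα.le ?_
    linarith
  have hfin := hxn.trans hsα
  refine ⟨x, ⟨hxX, ?_⟩, ?_, ?_⟩
  · rw [he2]
    exact hxeq
  · rw [he2]
    exact hfin
  · refine (Autoconv.eLpNorm_unitVol_le hσ.le (hm₀.sub x.memLp)).trans ?_
    rw [he2, mul_assoc]
    refine ENNReal.ofReal_le_ofReal (mul_le_mul_of_nonneg_left ?_ (Real.exp_pos σ).le)
    refine le_trans (le_of_eq ?_) hfin
    rw [Autoconv.SolutionSmoothness.elt]
    congr 1
    conv_rhs => rw [← Autoconv.toWL2_coeFn x]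
    rfl
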